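/- \textbf{Setting.} $\log$ is the logarithm to base $2$. $\mathcal{RH}_\infty$ is the set of real-rational proper transfer functions in $z$ all of whose poles lie strictly inside the unit disc. Consider the channel $Y(k)=U(k)+W(k)$, $k=0,1,2,\dots$, with noiseless feedback, where $W$ is a zero-mean stationary Gaussian sequence with power spectral density $\mathbb S_w(e^{j\theta})=|\mathbb H(e^{j\theta})|^2$ for some $\mathbb H\in\mathcal{RH}_\infty$ (that is, in law, $W$ is the steady-state output of $\mathbb H$ driven by white Gaussian noise of zero mean and unit variance), and $\mathbb S_w$ is not constant. \textbf{Coding scheme.} Let $\mathbb Q\in\mathcal{RH}_\infty$ be strictly causal (strictly proper) and $\mathbb K=\mathbb Q(1+\mathbb Q)^{-1}$. Take a controllable and observable real state-space realization $$A=\begin{bmatrix}A_s&0\\0&A_u\end{bmatrix},\quad B=\begin{bmatrix}B_s\\B_u\end{bmatrix},\quad C=\begin{bmatrix}C_s&C_u\end{bmatrix},\qquad C(zI-A)^{-1}B=\mathbb K,$$ where all eigenvalues of $A_s$ have modulus at most $1$ (automatically less than $1$ if $1+\mathbb Q$ has no zero on the unit circle) and all eigenvalues $\lambda_1(A_u),\dots,\lambda_m(A_u)$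 of the $m\times m$ matrix $A_u$, counted with algebraic multiplicity, have modulus greater than $1$. A message is represented by a point $x_0\in[-\tfrac12,\tfrac12]^m$. The decoder runs $$X_s(k+1)=A_sX_s(k)+B_sY(k),\quad \hat X_u(k+1)=A_u\hat X_u(k)+B_uY(k),\quad X_s(0)=0,\ \hat X_u(0)=0,$$ and feeds back $\hat U(k)=C_sX_s(k)+C_u\hat X_u(k)$; the encoder runs $\tilde X_u(k+1)=A_u\tilde X_u(k)$, $\tilde X_u(0)=x_0$, and sends $U(k)=C_u\tilde X_u(k)+\hat U(k)$. After $n$ channel uses the decoder forms the estimate $-A_u^{-n}\hat X_u(n)$ of $x_0$ and applies to it a measurable detection rule, which returns a message. \textbf{Theorem.} Such a realization of $\mathbb K$ exists, and for every such realization the following hold. (1) $\displaystyle \frac1{2\pi}\int_{-\pi}^{\pi}\log|1+\mathbb Q(e^{j\theta})|\,d\theta=\sum_{i=1}^m\log|\lambda_i(A_u)|.$ (2) The scheme achieves this number, in bits per channel use, as a reliable transmission rate in the sense of Shannon, with doubly exponentially decaying error probability: for every $R$ smaller than it there are, for each block length $n$, an assignment of $\lceil 2^{nR}\rceil$ messages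 to points of $[-\tfrac12,\tfrac12]^m$ and a detection rule such that the error probability $P_e^{(n)}$, averaged over the equiprobable messages, tends to $0$ and satisfies $P_e^{(n)}\le\exp(-c\,e^{\alpha n})$ for all large $n$, with constants $c,\alpha>0$. (3) The average input power $\frac1n\sum_{k<n}\mathbb E[U(k)^2]$ converges to $\frac1{2\pi}\int_{-\pi}^{\pi}|\mathbb Q(e^{j\theta})|^2\,\mathbb S_w(e^{j\theta})\,d\theta$ as $n\to\infty$, uniformly in $x_0\in[-\tfrac12,\tfrac12]^m$. -/

import Mathlib

open MeasureTheory ProbabilityTheory Filter Topology Matrix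

noncomputable section

namespace FeedbackCode

/-! ### Transfer functions

A real-rational transfer function in the variable `z` of the `z`-transform is an element of
`RatFunc ℝ`; `num` and `denom` are its coprime numerator and (monic) denominator. -/

/-- Real-rational, proper (causal), with all poles strictly inside the unit disc. -/
def IsRHInf (G : RatFunc ℝ) : Prop :=
  G.num.degree ≤ G.denom.degree ∧ ∀ z : ℂ, Polynomial.aeval z G.denom = 0 → ‖z‖ < 1

/-- Strictly proper transfer functions, i.e. the impulse response vanishes at time `0`. -/
def IsStrictlyCausal (G : RatFunc ℝ) : Prop :=
  G.num.degree < G.denom.degree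

/-- The frequency response `G(e^{jθ})`. -/
def freq (G : RatFunc ℝ) (θ : ℝ) : ℂ :=
  G.eval (algebraMap ℝ ℂ) (Complex.exp (θ * Complex.I))

/-! ### The channel noise -/

/-- The power spectral density `|H(e^{jθ})|²` of the output of `H` driven by white noise of unit
variance. -/
def psd (H : RatFunc ℝ) (θ : ℝ) : ℝ := ‖freq H θ‖ ^ 2

/-- The spectrum of the noise is not constant. -/
def IsColored (H : RatFunc ℝ) : Prop := ¬ ∃ c : ℝ, ∀ θ : ℝ, psd H θ = c

/-- `W` is a zero-mean stationary Gaussian sequence with power spectral density `|H(e^{jθ})|²`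
(equivalently, it has the law of the steady-state output of the stable filter `H` driven by
zero-mean white Gaussian noise of unit variance): its autocovariances are the Fourier coefficients
of the spectral density, which is an even function. -/
structure IsChannelNoise {Ω : Type*} [MeasurableSpace Ω] (H : RatFunc ℝ) (W : ℕ → Ω → ℝ)
    (P : Measure Ω) : Prop where
  gaussian : IsGaussianProcess W P
  mean_zero : ∀ i, ∫ ω, W i ω ∂P = 0
  autocov : ∀ i j, covariance (W i) (W j) P =
    1 / (2 * Real.pi) *
      ∫ θ in (-Real.pi)..Real.pi, psd H θ * Real.cos (((i : ℝ) - (j : ℝ)) * θ)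

/-! ### State-space realizations -/

/-- The complex eigenvalues of a real matrix, with algebraic multiplicity. -/
def eigenvalues {ι : Type*} [Fintype ι] [DecidableEq ι] (A : Matrix ι ι ℝ) : Multiset ℂ :=
  (A.map (algebraMap ℝ ℂ)).charpoly.roots

/-- The transfer function `C (zI - A)⁻¹ B` of the single-input single-output system
`x(k+1) = A x(k) + B y(k)`, `u(k) = C x(k)`. -/
def transferFunction {ι : Type*} [Fintype ι] [DecidableEq ι] (A : Matrix ι ι ℝ) (B C : ι → ℝ) :
    RatFunc ℝ :=
  (fun i => RatFunc.C (C i)) ⬝ᵥ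
    ((Matrix.scalar ι (RatFunc.X : RatFunc ℝ) - A.map RatFunc.C)⁻¹ *ᵥ fun i => RatFunc.C (B i))

/-- The reachable subspace, spanned by `B, AB, A²B, …`, is everything. -/
def IsControllable {ι : Type*} [Fintype ι] [DecidableEq ι] (A : Matrix ι ι ℝ) (B : ι → ℝ) : Prop :=
  Submodule.span ℝ (Set.range fun k : ℕ => (A ^ k) *ᵥ B) = ⊤

/-- The only unobservable state is `0`. -/
def IsObservable {ι : Type*} [Fintype ι] [DecidableEq ι] (A : Matrix ι ι ℝ) (C : ι → ℝ) : Prop :=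
  ∀ x : ι → ℝ, (∀ k : ℕ, C ⬝ᵥ ((A ^ k) *ᵥ x) = 0) → x = 0

/-- A controllable and observable realization of `K`, block-diagonal with a block `As` without
eigenvalues outside the closed unit disc and a block `Au` all of whose eigenvalues lie strictly
outside. (If `K` has no pole on the unit circle, the eigenvalues of `As`, being poles of `K`, are
strictly inside the unit disc.) -/
structure Realization (K : RatFunc ℝ) (s m : ℕ) where
  As : Matrix (Fin s) (Fin s) ℝ
  Au : Matrix (Fin m) (Fin m) ℝ
  Bs : Fin s → ℝ
  Bu : Fin m → ℝ
  Cs : Fin s → ℝ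
  Cu : Fin m → ℝ
  eig_s : ∀ z ∈ eigenvalues As, ‖z‖ ≤ 1
  eig_u : ∀ z ∈ eigenvalues Au, 1 < ‖z‖
  controllable : IsControllable (Matrix.fromBlocks As 0 0 Au) (Sum.elim Bs Bu)
  observable : IsObservable (Matrix.fromBlocks As 0 0 Au) (Sum.elim Cs Cu)
  transfer : transferFunction (Matrix.fromBlocks As 0 0 Au) (Sum.elim Bs Bu) (Sum.elim Cs Cu) = K

/-! ### The linear coding scheme -/

/-- The joint state of the decoder (`xs`, `xhat`) and of the encoder (`xtil`). -/
structure LoopState (s m : ℕ) where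
  xs : Fin s → ℝ
  xhat : Fin m → ℝ
  xtil : Fin m → ℝ

namespace Realization

variable {K : RatFunc ℝ} {s m : ℕ} (S : Realization K s m)

/-- The feedback signal `Û = C_s X_s + C_u X̂_u` which the decoder produces. -/
def feedback (p : LoopState s m) : ℝ := S.Cs ⬝ᵥ p.xs + S.Cu ⬝ᵥ p.xhat

/-- The channel input `U = C_u X̃_u + Û` which the encoder produces. -/
def input (p : LoopState s m) : ℝ := S.Cu ⬝ᵥ p.xtil + S.feedback p

/-- One channel use with channel output `y`: the decoder runs `K` driven by `y`, the encoder runs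
its autonomous dynamics. -/
def step (p : LoopState s m) (y : ℝ) : LoopState s m where
  xs := S.As *ᵥ p.xs + y • S.Bs
  xhat := S.Au *ᵥ p.xhat + y • S.Bu
  xtil := S.Au *ᵥ p.xtil

/-- The closed loop over the channel `Y(k) = U(k) + W(k)`, for the message point `x₀`, the initial
state of the encoder, and the noise path `w`. -/
def loop (x₀ : Fin m → ℝ) (w : ℕ → ℝ) : ℕ → LoopState s m
  | 0 => ⟨0, 0, x₀⟩
  | k + 1 => S.step (loop x₀ w k) (S.input (loop x₀ w k) + w k)

/-- The channel input `U(k)`. -/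
def channelInput (x₀ : Fin m → ℝ) (w : ℕ → ℝ) (k : ℕ) : ℝ := S.input (S.loop x₀ w k)

/-- The estimate `-A_u^{-n} X̂_u(n)` of the message point `x₀` which the decoder forms from the first
`n` channel outputs `Y(0), …, Y(n-1)`. -/
def estimate (x₀ : Fin m → ℝ) (w : ℕ → ℝ) (n : ℕ) : Fin m → ℝ :=
  -((S.Au⁻¹ ^ n) *ᵥ (S.loop x₀ w n).xhat)

/-- The expected average power `(1/n) ∑_{k<n} E[U(k)²]` when the message point `x₀` is sent. -/
def avgPower {Ω : Type*} [MeasurableSpace Ω] (P : Measure Ω) (W : ℕ → Ω → ℝ) (n : ℕ)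
    (x₀ : Fin m → ℝ) : ℝ :=
  1 / (n : ℝ) * ∑ k ∈ Finset.range n, ∫ ω, S.channelInput x₀ (fun i => W i ω) k ^ 2 ∂P

end Realization

/-- The cube `[-1/2, 1/2]^m` of admissible message points. -/
def messageCube (m : ℕ) : Set (Fin m → ℝ) := {x | ∀ i, |x i| ≤ 1 / 2}

/-- The assignment of `M` messages to points of the unit cube, and the detection rule which turns
an estimate of the message point into a decoded message. -/
structure Signalling (m M : ℕ) where
  point : Fin M → Fin m → ℝ
  point_mem : ∀ j, point j ∈ messageCube m
  detect : (Fin m → ℝ) → Fin M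
  measurable_detect : Measurable detect

/-- The error probability of the block code of length `n`, averaged over equiprobable messages. -/
def errorProb {Ω : Type*} [MeasurableSpace Ω] (P : Measure Ω) (W : ℕ → Ω → ℝ)
    {K : RatFunc ℝ} {s m : ℕ} (S : Realization K s m) (n : ℕ) {M : ℕ} (c : Signalling m M) : ℝ :=
  1 / (M : ℝ) * ∑ j : Fin M,
    P.real {ω | c.detect (S.estimate (c.point j) (fun i => W i ω) n) ≠ j}

/-- Doubly exponential decay: `p n ≤ exp (-c exp (α n))` for all large `n`, with `c, α > 0`. -/
def DoublyExponentialDecay (p : ℕ → ℝ) : Prop :=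
  ∃ c > (0 : ℝ), ∃ α > (0 : ℝ), ∀ᶠ n : ℕ in atTop, p n ≤ Real.exp (-(c * Real.exp (α * n)))

/-- Reliable transmission at the rate `C` (in bits per channel use) in the sense of Shannon, with
doubly exponentially decaying error probability: for every `R < C` there are block codes with
`2^{nR}` messages (rounded up) for all block lengths `n`, whose error probabilities tend to `0`
doubly exponentially fast. -/
def AchievesRate {Ω : Type*} [MeasurableSpace Ω] (P : Measure Ω) (W : ℕ → Ω → ℝ)
    {K : RatFunc ℝ} {s m : ℕ} (S : Realization K s m) (C : ℝ) : Prop :=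
  ∀ R < C, ∃ c : ∀ n : ℕ, Signalling m ⌈(2 : ℝ) ^ ((n : ℝ) * R)⌉₊,
    Tendsto (fun n => errorProb P W S n (c n)) atTop (𝓝 0) ∧
    DoublyExponentialDecay (fun n => errorProb P W S n (c n))

/-- `(1/2π) ∫_{-π}^{π} log₂ |1 + Q(e^{jθ})| dθ`. -/
def rate (Q : RatFunc ℝ) : ℝ :=
  1 / (2 * Real.pi) * ∫ θ in (-Real.pi)..Real.pi, Real.logb 2 ‖1 + freq Q θ‖

/-- `(1/2π) ∫_{-π}^{π} |Q(e^{jθ})|² S_w(e^{jθ}) dθ`. -/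
def power (Q H : RatFunc ℝ) : ℝ :=
  1 / (2 * Real.pi) * ∫ θ in (-Real.pi)..Real.pi, ‖freq Q θ‖ ^ 2 * psd H θ

end FeedbackCode

end

noncomputable section

namespace FeedbackCode

open Polynomial

/-! Encoder and decoder together form one linear system. In the state `x = (X_s, X̂_u + X̃_u)` the
input is `U = C x`, and `x(k+1) = (A + BC) x(k) + B W(k)`: the message enters only through the
initial state. Closing the loop undoes `K = Q(1+Q)⁻¹`, since the transfer function from `W` to `U`
is `K/(1-K) = Q`. Write `Q = N/D` in lowest terms. By minimality (`charpoly_eq_denom`) the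
characteristic polynomial of `A` is the denominator `D + N` of `K`, and by the matrix determinant
lemma that of `A + BC` is `D`. So the closed loop is internally stable although `A_u` is not.

Rate: apply Jensen's formula to `1 + Q = (D+N)/D`. The roots of `D` lie in the disc and contribute
nothing; `D + N` contributes its roots outside the disc, which are the eigenvalues of `A_u`
(`rate_eq_sum`). Equivalently, `|det A_u| = 2 ^ rate Q`.

Reliability: `A_u^n` applied to the estimation error is, up to sign, the unstable part of the stable
closed-loop state, hence Gaussian with mean and variance bounded uniformly in `n` and `x₀`. Off an
event of doubly exponentially small probability the error therefore lies in the preimage under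
`A_u^n` of a ball of radius `exp (α n)`. Such a preimage has volume `(2 exp (α n))^m / 2^(n rate)`,
so for `R` below the rate and small `α` a greedy volume argument (`exists_signalling`) places
`⌈2^(nR)⌉` distinguishable points in the unit cube.

Power: the mean of `U(k)` decays geometrically, uniformly in the message point, and its variance is
the integral of the squared modulus of a truncated impulse response against the noise spectrum. The
truncations converge to `Q` in modulus on the circle; dominated convergence and Cesàro averaging
conclude. -/

lemma comp_mulVec {ι : Type*} [Fintype ι] (A : Matrix ι ι ℝ) (v : ι → ℝ) :
    (RatFunc.C ∘ (A *ᵥ v) : ι → RatFunc ℝ) = A.map RatFunc.C *ᵥ (RatFunc.C ∘ v) := by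
  ext i
  simp [Matrix.mulVec, dotProduct]

lemma comp_dotProduct {ι : Type*} [Fintype ι] (v w : ι → ℝ) :
    ((RatFunc.C ∘ v) ⬝ᵥ (RatFunc.C ∘ w) : RatFunc ℝ) = RatFunc.C (v ⬝ᵥ w) := by
  simp [dotProduct]

/-! ### Algebra of the transfer functions `C (zI - A)⁻¹ B` -/

section Transfer

variable {ι : Type*} [Fintype ι] [DecidableEq ι]

/-- The pencil `zI - A` over the field of rational functions. -/
def pencil (A : Matrix ι ι ℝ) : Matrix ι ι (RatFunc ℝ) :=
  Matrix.scalar ι (RatFunc.X : RatFunc ℝ) - A.map RatFunc.C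

lemma pencil_eq_map_charmatrix (A : Matrix ι ι ℝ) :
    pencil A = (charmatrix A).map (algebraMap ℝ[X] (RatFunc ℝ)) := by
  ext i j
  by_cases h : i = j
  · subst h; simp [pencil, charmatrix]
  · simp [pencil, charmatrix, h]

lemma det_pencil (A : Matrix ι ι ℝ) :
    (pencil A).det = algebraMap ℝ[X] (RatFunc ℝ) A.charpoly := by
  rw [pencil_eq_map_charmatrix, Matrix.charpoly, RingHom.map_det]
  rfl

lemma algebraMap_charpoly_ne_zero (A : Matrix ι ι ℝ) :
    algebraMap ℝ[X] (RatFunc ℝ) A.charpoly ≠ 0 := by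
  simpa using A.charpoly_monic.ne_zero

lemma isUnit_det_pencil (A : Matrix ι ι ℝ) : IsUnit (pencil A).det := by
  rw [det_pencil]
  exact (algebraMap_charpoly_ne_zero A).isUnit

lemma transferFunction_eq (A : Matrix ι ι ℝ) (B C : ι → ℝ) :
    transferFunction A B C = (RatFunc.C ∘ C) ⬝ᵥ ((pencil A)⁻¹ *ᵥ (RatFunc.C ∘ B)) := rfl

/-- A scalar equals its transpose. This duality exchanges input and output vectors, and so
controllability and observability. -/
lemma transferFunction_transpose (A : Matrix ι ι ℝ) (B C : ι → ℝ) :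
    transferFunction Aᵀ C B = transferFunction A B C := by
  have h : pencil Aᵀ = (pencil A)ᵀ := by
    simp [pencil, Matrix.transpose_sub, Matrix.transpose_map]
  rw [transferFunction_eq, transferFunction_eq, h, ← Matrix.transpose_nonsing_inv,
    Matrix.mulVec_transpose, dotProduct_comm, ← Matrix.dotProduct_mulVec]

lemma transferFunction_add_left (A : Matrix ι ι ℝ) (B B' C : ι → ℝ) :
    transferFunction A (B + B') C = transferFunction A B C + transferFunction A B' C := by
  have : RatFunc.C ∘ (B + B') = RatFunc.C ∘ B + RatFunc.C ∘ B' := by ext; simp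
  simp only [transferFunction_eq, this, Matrix.mulVec_add, dotProduct_add]

lemma transferFunction_smul_left (A : Matrix ι ι ℝ) (a : ℝ) (B C : ι → ℝ) :
    transferFunction A (a • B) C = RatFunc.C a * transferFunction A B C := by
  have : RatFunc.C ∘ (a • B) = RatFunc.C a • (RatFunc.C ∘ B) := by ext; simp
  simp only [transferFunction_eq, this, Matrix.mulVec_smul, dotProduct_smul, smul_eq_mul]

lemma transferFunction_zero_left (A : Matrix ι ι ℝ) (C : ι → ℝ) :
    transferFunction A 0 C = 0 := by
  simpa using transferFunction_smul_left A 0 0 C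

lemma transferFunction_add_right (A : Matrix ι ι ℝ) (B C C' : ι → ℝ) :
    transferFunction A B (C + C') = transferFunction A B C + transferFunction A B C' := by
  simp only [← transferFunction_transpose A B, transferFunction_add_left]

lemma transferFunction_smul_right (A : Matrix ι ι ℝ) (a : ℝ) (B C : ι → ℝ) :
    transferFunction A B (a • C) = RatFunc.C a * transferFunction A B C := by
  simp only [← transferFunction_transpose A B, transferFunction_smul_left]

/-- The resolvent identity `z (zI - A)⁻¹ = I + (zI - A)⁻¹ A`. -/
lemma X_mul_transferFunction (A : Matrix ι ι ℝ) (B C : ι → ℝ) :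
    RatFunc.X * transferFunction A B C =
      RatFunc.C (C ⬝ᵥ B) + transferFunction A (A *ᵥ B) C := by
  set b : ι → RatFunc ℝ := RatFunc.C ∘ B
  have h1 : (pencil A)⁻¹ *ᵥ (pencil A *ᵥ b) = b := by
    rw [Matrix.mulVec_mulVec, Matrix.nonsing_inv_mul _ (isUnit_det_pencil A), Matrix.one_mulVec]
  have h2 : pencil A *ᵥ b = (RatFunc.X : RatFunc ℝ) • b - RatFunc.C ∘ (A *ᵥ B) := by
    rw [pencil, Matrix.sub_mulVec, ← comp_mulVec]
    congr 1
    ext i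
    simp [Matrix.scalar_apply, Matrix.mulVec_diagonal]
  rw [h2, Matrix.mulVec_sub, Matrix.mulVec_smul] at h1
  have h3 := congrArg (fun x => (RatFunc.C ∘ C) ⬝ᵥ x) h1
  simp only [dotProduct_sub, dotProduct_smul, smul_eq_mul] at h3
  rw [← transferFunction_eq, ← transferFunction_eq, comp_dotProduct] at h3
  linear_combination h3

/-- The resolvent identity iterated. The coefficients `C A^j B` of the polynomial part are the
impulse response, and the remainder is small when `A ^ n` is; this later gives convergence on the
unit circle. -/
lemma X_pow_mul_transferFunction (A : Matrix ι ι ℝ) (B C : ι → ℝ) (n : ℕ) :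
    RatFunc.X ^ n * transferFunction A B C =
      algebraMap ℝ[X] (RatFunc ℝ)
        (∑ j ∈ Finset.range n, Polynomial.C (C ⬝ᵥ (A ^ j *ᵥ B)) * Polynomial.X ^ (n - 1 - j)) +
      transferFunction A (A ^ n *ᵥ B) C := by
  induction n with
  | zero => simp
  | succ n ih =>
    have h : ∑ j ∈ Finset.range (n + 1),
        Polynomial.C (C ⬝ᵥ (A ^ j *ᵥ B)) * (Polynomial.X : ℝ[X]) ^ (n + 1 - 1 - j) =
        Polynomial.X * (∑ j ∈ Finset.range n,
          Polynomial.C (C ⬝ᵥ (A ^ j *ᵥ B)) * Polynomial.X ^ (n - 1 - j)) +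
        Polynomial.C (C ⬝ᵥ (A ^ n *ᵥ B)) := by
      rw [Finset.sum_range_succ, Finset.mul_sum]
      congr 1
      · refine Finset.sum_congr rfl fun j hj => ?_
        have : n + 1 - 1 - j = (n - 1 - j) + 1 := by have := Finset.mem_range.1 hj; omega
        rw [this, pow_succ]; ring
      · simp
    rw [h, pow_succ', mul_assoc, ih, mul_add, X_mul_transferFunction, Matrix.mulVec_mulVec,
      ← pow_succ']
    simp only [map_add, map_mul, RatFunc.algebraMap_X, RatFunc.algebraMap_C]
    ring

/-- Multiplication of a transfer function by a polynomial `p` amounts, up to a polynomial of degree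
less than that of `p`, to applying `p(A)` to the input vector. -/
lemma exists_mul_transferFunction (A : Matrix ι ι ℝ) (B C : ι → ℝ) (p : ℝ[X]) (n : ℕ)
    (hp : p.natDegree ≤ n) :
    ∃ g : ℝ[X], g.degree < n ∧ algebraMap ℝ[X] (RatFunc ℝ) p * transferFunction A B C =
      algebraMap ℝ[X] (RatFunc ℝ) g + transferFunction A (aeval A p *ᵥ B) C := by
  refine Polynomial.induction_with_natDegree_le
    (fun p => ∃ g : ℝ[X], g.degree < n ∧ algebraMap ℝ[X] (RatFunc ℝ) p * transferFunction A B C =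
      algebraMap ℝ[X] (RatFunc ℝ) g + transferFunction A (aeval A p *ᵥ B) C) n ?_ ?_ ?_ p hp
  · exact ⟨0, by simp [transferFunction_zero_left]⟩
  · intro k r hr hk
    refine ⟨Polynomial.C r * ∑ j ∈ Finset.range k,
      Polynomial.C (C ⬝ᵥ (A ^ j *ᵥ B)) * Polynomial.X ^ (k - 1 - j), ?_, ?_⟩
    · rw [← Polynomial.mem_degreeLT, ← Polynomial.smul_eq_C_mul]
      refine Submodule.smul_mem _ _ (Submodule.sum_mem _ fun j hj => ?_)
      rw [Polynomial.mem_degreeLT]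
      refine (Polynomial.degree_C_mul_X_pow_le _ _).trans_lt ?_
      have := Finset.mem_range.1 hj
      exact_mod_cast (by omega : k - 1 - j < n)
    · have := X_pow_mul_transferFunction A B C k
      simp only [map_mul, map_pow, RatFunc.algebraMap_X, RatFunc.algebraMap_C, mul_assoc, this,
        aeval_X, aeval_C]
      rw [mul_add, ← Matrix.mulVec_mulVec, Algebra.algebraMap_eq_smul_one (A := Matrix ι ι ℝ),
        Matrix.smul_mulVec, Matrix.one_mulVec, transferFunction_smul_left]
  · rintro f g hfg hg ⟨a, ha, ha'⟩ ⟨b, hb, hb'⟩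
    refine ⟨a + b, (Polynomial.degree_add_le _ _).trans_lt (max_lt ha hb), ?_⟩
    rw [map_add, add_mul, ha', hb', map_add, map_add, Matrix.add_mulVec, transferFunction_add_left]
    ring

/-- By Cayley–Hamilton the remainder in `exists_mul_transferFunction` vanishes for the
characteristic polynomial. -/
lemma exists_numerator (A : Matrix ι ι ℝ) (B C : ι → ℝ) :
    ∃ g : ℝ[X], g.degree < Fintype.card ι ∧
      algebraMap ℝ[X] (RatFunc ℝ) A.charpoly * transferFunction A B C =
        algebraMap ℝ[X] (RatFunc ℝ) g := by
  obtain ⟨g, hg, h⟩ := exists_mul_transferFunction A B C A.charpoly _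
    (A.charpoly_natDegree_eq_dim).le
  refine ⟨g, hg, ?_⟩
  rw [h, Matrix.aeval_self_charpoly, Matrix.zero_mulVec, transferFunction_zero_left, add_zero]

/-- A transfer function `C (zI - A)⁻¹ B` is strictly proper, so it is not a nonzero polynomial. -/
lemma eq_zero_of_transferFunction_eq_algebraMap (A : Matrix ι ι ℝ) (B C : ι → ℝ) (p : ℝ[X])
    (h : transferFunction A B C = algebraMap ℝ[X] (RatFunc ℝ) p) : p = 0 := by
  obtain ⟨g, hg, h'⟩ := exists_numerator A B C
  rw [h, ← map_mul] at h'
  have h2 : A.charpoly * p = g := RatFunc.algebraMap_injective ℝ h'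
  by_contra hp
  rw [← h2, Polynomial.degree_mul, A.charpoly_degree_eq_dim,
    Polynomial.degree_eq_natDegree hp] at hg
  have : Fintype.card ι + p.natDegree < Fintype.card ι := by exact_mod_cast hg
  omega

/-- Multiplying a vanishing transfer function by `z` leaves a strictly proper function equal to a
constant. Both must be zero, and the argument repeats with `A *ᵥ B` as input vector. -/
lemma dotProduct_pow_mulVec_eq_zero (A : Matrix ι ι ℝ) (B C : ι → ℝ)
    (h : transferFunction A B C = 0) (k : ℕ) : C ⬝ᵥ (A ^ k *ᵥ B) = 0 := by
  have key : ∀ v, transferFunction A v C = 0 →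
      C ⬝ᵥ v = 0 ∧ transferFunction A (A *ᵥ v) C = 0 := by
    intro v hv
    have h1 := X_mul_transferFunction A v C
    rw [hv, mul_zero] at h1
    have h2 : transferFunction A (A *ᵥ v) C =
        algebraMap ℝ[X] (RatFunc ℝ) (Polynomial.C (-(C ⬝ᵥ v))) := by
      rw [RatFunc.algebraMap_C, map_neg]
      linear_combination -h1
    have h3 := eq_zero_of_transferFunction_eq_algebraMap _ _ _ _ h2
    refine ⟨by simpa using h3, ?_⟩
    rw [h2, h3, map_zero]
  have h0 : ∀ k, transferFunction A (A ^ k *ᵥ B) C = 0 := by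
    intro k
    induction k with
    | zero => simpa using h
    | succ k ih => rw [pow_succ', ← Matrix.mulVec_mulVec]; exact (key _ ih).2
  exact (key _ (h0 k)).1

/-! ### Controllability, observability and minimality -/

/-- A controllable vector is annihilated by no `p(A) ≠ 0`, so that the dimension of the state space
is at most the degree of any polynomial which annihilates it. -/
lemma IsControllable.card_le_natDegree {A : Matrix ι ι ℝ} {B : ι → ℝ} (h : IsControllable A B)
    {p : ℝ[X]} (hp : p.Monic) (hpB : aeval A p *ᵥ B = 0) : Fintype.card ι ≤ p.natDegree := by
  have hspan : (⊤ : Submodule ℝ (ι → ℝ)) ≤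
      Submodule.span ℝ (Set.range fun k : Fin p.natDegree => A ^ (k : ℕ) *ᵥ B) := by
    rw [← h, Submodule.span_le]
    rintro _ ⟨k, rfl⟩
    have h1 : aeval A (X ^ k : ℝ[X]) *ᵥ B = aeval A ((X ^ k : ℝ[X]) %ₘ p) *ᵥ B := by
      conv_lhs => rw [← Polynomial.modByMonic_add_div (X ^ k : ℝ[X]) p]
      rw [map_add, Matrix.add_mulVec, mul_comm p, map_mul, ← Matrix.mulVec_mulVec, hpB,
        Matrix.mulVec_zero, add_zero]
    have h2 : A ^ k *ᵥ B = aeval A (X ^ k : ℝ[X]) *ᵥ B := by simp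
    by_cases hp1 : p = 1
    · subst hp1
      simp only [map_one, Matrix.one_mulVec] at hpB
      simp [hpB]
    have hdeg : ((X ^ k : ℝ[X]) %ₘ p).natDegree < p.natDegree :=
      Polynomial.natDegree_modByMonic_lt _ hp hp1
    simp only [h2, h1]
    rw [Polynomial.aeval_eq_sum_range' hdeg, Matrix.sum_mulVec]
    refine Submodule.sum_mem _ fun i hi => ?_
    rw [Matrix.smul_mulVec]
    exact Submodule.smul_mem _ _ (Submodule.subset_span ⟨⟨i, Finset.mem_range.1 hi⟩, rfl⟩)
  have h3 := finrank_range_le_card (R := ℝ) fun k : Fin p.natDegree => A ^ (k : ℕ) *ᵥ B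
  rw [Set.finrank, top_le_iff.1 hspan, finrank_top, Module.finrank_fintype_fun_eq_card,
    Fintype.card_fin] at h3
  exact h3

lemma denom_mul_eq (K : RatFunc ℝ) :
    algebraMap ℝ[X] (RatFunc ℝ) K.denom * K = algebraMap ℝ[X] (RatFunc ℝ) K.num := by
  have h := RatFunc.num_div_denom K
  have h0 : algebraMap ℝ[X] (RatFunc ℝ) K.denom ≠ 0 := by simpa using K.denom_ne_zero
  rw [div_eq_iff h0] at h
  rw [h, mul_comm]

lemma denom_dvd_of_mul_eq {K : RatFunc ℝ} {p q : ℝ[X]}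
    (h : algebraMap ℝ[X] (RatFunc ℝ) p * K = algebraMap ℝ[X] (RatFunc ℝ) q) : K.denom ∣ p := by
  have h1 : p * K.num = q * K.denom := by
    apply RatFunc.algebraMap_injective ℝ
    rw [map_mul, map_mul, ← denom_mul_eq, ← h]
    ring
  exact (RatFunc.isCoprime_num_denom K).symm.dvd_of_dvd_mul_right
    (h1 ▸ Dvd.intro_left q rfl)

/-- The characteristic polynomial of a minimal realization is the denominator of its transfer
function. -/
theorem charpoly_eq_denom {A : Matrix ι ι ℝ} {B C : ι → ℝ} (hc : IsControllable A B)
    (ho : IsObservable A C) : A.charpoly = (transferFunction A B C).denom := by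
  set K := transferFunction A B C with hK
  set E := K.denom with hE
  have hEm : E.Monic := RatFunc.monic_denom K
  -- Since `E * K` is a polynomial, the transfer function with input vector `E(A) B` is a polynomial
  -- too, hence zero. So `E(A) B` is an unobservable state.
  have h0 : aeval A E *ᵥ B = 0 := by
    obtain ⟨g, -, hg⟩ := exists_mul_transferFunction A B C E _ le_rfl
    have h1 : transferFunction A (aeval A E *ᵥ B) C =
        algebraMap ℝ[X] (RatFunc ℝ) (K.num - g) := by
      rw [map_sub, ← denom_mul_eq, ← hE, hK]
      linear_combination -hg
    have h2 := eq_zero_of_transferFunction_eq_algebraMap _ _ _ _ h1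
    rw [h2, map_zero] at h1
    exact ho _ (dotProduct_pow_mulVec_eq_zero _ _ _ h1)
  obtain ⟨g, -, hg⟩ := exists_numerator A B C
  have hdvd : E ∣ A.charpoly := denom_dvd_of_mul_eq hg
  refine (Polynomial.eq_of_monic_of_dvd_of_natDegree_le hEm A.charpoly_monic hdvd ?_)
  rw [A.charpoly_natDegree_eq_dim]
  exact hc.card_le_natDegree hEm h0

/-- The input vector is annihilated by a polynomial in `A` whose degree is the dimension of the
reachable subspace. -/
lemma exists_monic_annihilator (A : Matrix ι ι ℝ) (B : ι → ℝ) :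
    ∃ p : ℝ[X], p.Monic ∧ aeval A p *ᵥ B = 0 ∧ p.natDegree =
      Module.finrank ℝ (Submodule.span ℝ (Set.range fun k : ℕ => (A ^ k) *ᵥ B)) := by
  set V := Submodule.span ℝ (Set.range fun k : ℕ => (A ^ k) *ᵥ B) with hV
  have hinv : ∀ x ∈ V, Matrix.toLin' A x ∈ V := by
    intro x hx
    rw [← Submodule.mem_comap]
    revert hx x
    change V ≤ _
    rw [hV, Submodule.span_le]
    rintro _ ⟨k, rfl⟩
    refine Submodule.subset_span ⟨k + 1, ?_⟩
    simp [pow_succ']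
  -- The annihilator is the characteristic polynomial of `A` restricted to the invariant reachable
  -- subspace, by Cayley–Hamilton there.
  let T : Module.End ℝ V := (Matrix.toLin' A).restrict hinv
  have hB : B ∈ V := Submodule.subset_span ⟨0, by simp⟩
  let p := T.charpoly
  have hT : ∀ (q : ℝ[X]) (x : V), ((aeval T q x : V) : ι → ℝ) = aeval A q *ᵥ (x : ι → ℝ) := by
    intro q x
    induction q using Polynomial.induction_on' generalizing x with
    | add a b ha hb => simp [ha, hb, Matrix.add_mulVec]
    | monomial n a =>
      have : ∀ (n : ℕ) (x : V), ((T ^ n) x : ι → ℝ) = A ^ n *ᵥ (x : ι → ℝ) := by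
        intro n
        induction n with
        | zero => simp
        | succ n ih =>
          intro x
          rw [pow_succ, pow_succ, Module.End.mul_apply, ih, ← Matrix.mulVec_mulVec]
          rfl
      rw [aeval_monomial, aeval_monomial, Module.End.mul_apply, Module.algebraMap_end_apply,
        Submodule.coe_smul, this, ← Matrix.mulVec_mulVec, Algebra.algebraMap_eq_smul_one,
        Matrix.smul_mulVec, Matrix.one_mulVec]
  have hpB : aeval A p *ᵥ B = 0 := by
    rw [← hT p ⟨B, hB⟩, LinearMap.aeval_self_charpoly]; rfl
  exact ⟨p, LinearMap.charpoly_monic T, hpB, LinearMap.charpoly_natDegree T⟩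

/-- Some nonzero annihilator of `B` has the dimension of the reachable subspace as its degree; being
a multiple of `E`, it forces that dimension to be full. -/
lemma isControllable_of_forall_dvd {A : Matrix ι ι ℝ} {B : ι → ℝ} {E : ℝ[X]}
    (hE : ∀ q : ℝ[X], aeval A q *ᵥ B = 0 → E ∣ q) (h : Fintype.card ι ≤ E.natDegree) :
    IsControllable A B := by
  obtain ⟨p, hp, hpB, hdeg⟩ := exists_monic_annihilator A B
  refine Submodule.eq_top_of_finrank_eq (le_antisymm (Submodule.finrank_le _) ?_)
  rw [Module.finrank_fintype_fun_eq_card, ← hdeg]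
  exact h.trans (Polynomial.natDegree_le_of_dvd (hE p hpB) hp.ne_zero)

/-- A realization whose dimension is the degree of the denominator is controllable. -/
lemma isControllable_of_card_le {A : Matrix ι ι ℝ} {B C : ι → ℝ}
    (h : Fintype.card ι ≤ (transferFunction A B C).denom.natDegree) : IsControllable A B := by
  refine isControllable_of_forall_dvd (fun q hq => ?_) h
  obtain ⟨g, -, hg⟩ := exists_mul_transferFunction A B C q _ le_rfl
  rw [hq, transferFunction_zero_left, add_zero] at hg
  exact denom_dvd_of_mul_eq hg

/-- An unobservable state is orthogonal to every `(Aᵀ)^k C`, hence to the whole space, and in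
particular to itself. -/
lemma IsControllable.isObservable_transpose {A : Matrix ι ι ℝ} {C : ι → ℝ}
    (h : IsControllable Aᵀ C) : IsObservable A C := by
  intro x hx
  have h1 : ∀ y : ι → ℝ, y ⬝ᵥ x = 0 := by
    intro y
    have hy : y ∈ Submodule.span ℝ (Set.range fun k : ℕ => (Aᵀ ^ k) *ᵥ C) := by
      rw [show Submodule.span ℝ (Set.range fun k : ℕ => (Aᵀ ^ k) *ᵥ C) = ⊤ from h]; trivial
    induction hy using Submodule.span_induction with
    | mem y hy =>
      obtain ⟨k, rfl⟩ := hy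
      simp only
      rw [← Matrix.transpose_pow, Matrix.mulVec_transpose, ← Matrix.dotProduct_mulVec]
      exact hx k
    | zero => simp
    | add a b _ _ ha hb => rw [add_dotProduct, ha, hb, add_zero]
    | smul c a _ ha => rw [smul_dotProduct, ha, smul_zero]
  exact dotProduct_self_eq_zero.1 (h1 x)

lemma isObservable_of_card_le {A : Matrix ι ι ℝ} {B C : ι → ℝ}
    (h : Fintype.card ι ≤ (transferFunction A B C).denom.natDegree) : IsObservable A C :=
  (isControllable_of_card_le (C := B) (by rwa [transferFunction_transpose])).isObservable_transpose

/-! ### Closing the loop -/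

lemma pencil_add_vecMulVec (A : Matrix ι ι ℝ) (B C : ι → ℝ) :
    pencil (A + vecMulVec B C) = pencil A - vecMulVec (RatFunc.C ∘ B) (RatFunc.C ∘ C) := by
  ext i j
  simp [pencil, vecMulVec_apply]
  ring

/-- Matrix determinant lemma for the rank-one perturbation `zI - A - BC` of the pencil. -/
lemma charpoly_add_vecMulVec (A : Matrix ι ι ℝ) (B C : ι → ℝ) :
    algebraMap ℝ[X] (RatFunc ℝ) (A + vecMulVec B C).charpoly =
      algebraMap ℝ[X] (RatFunc ℝ) A.charpoly * (1 - transferFunction A B C) := by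
  have h := Matrix.det_add_replicateCol_mul_replicateRow (ι := Unit) (isUnit_det_pencil A)
    (-(RatFunc.C ∘ B)) (RatFunc.C ∘ C)
  have h1 : pencil A + replicateCol Unit (-(RatFunc.C ∘ B)) * replicateRow Unit (RatFunc.C ∘ C) =
      pencil (A + vecMulVec B C) := by
    rw [pencil_add_vecMulVec, sub_eq_add_neg]
    congr 1
    ext i j
    simp [vecMulVec_apply, Matrix.mul_apply]
  have h2 : (1 + replicateRow Unit (RatFunc.C ∘ C) * (pencil A)⁻¹ *
      replicateCol Unit (-(RatFunc.C ∘ B))).det = 1 - transferFunction A B C := by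
    rw [Matrix.det_unique, transferFunction_eq, Matrix.dotProduct_mulVec, sub_eq_add_neg]
    rw [Matrix.add_apply, Matrix.one_apply_eq, ← dotProduct_neg]
    rfl
  rw [h1, h2, det_pencil, det_pencil] at h
  exact h

/-- The solution of `(zI - A - BC) x = B` satisfies `(zI - A) x = (1 + C x) B`, that is, `q = (1 +
q) K` for `q = C x`. This form avoids dividing by `1 - K`. -/
lemma transferFunction_add_vecMulVec (A : Matrix ι ι ℝ) (B C : ι → ℝ) :
    transferFunction (A + vecMulVec B C) B C * (1 - transferFunction A B C) =
      transferFunction A B C := by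
  set q := transferFunction (A + vecMulVec B C) B C with hq
  set b : ι → RatFunc ℝ := RatFunc.C ∘ B
  set c : ι → RatFunc ℝ := RatFunc.C ∘ C
  set x := (pencil (A + vecMulVec B C))⁻¹ *ᵥ b with hx
  have h1 : pencil (A + vecMulVec B C) *ᵥ x = b := by
    rw [hx, Matrix.mulVec_mulVec, Matrix.mul_nonsing_inv _ (isUnit_det_pencil _),
      Matrix.one_mulVec]
  have hqx : q = c ⬝ᵥ x := rfl
  have h2 : pencil A *ᵥ x = (1 + q) • b := by
    rw [pencil_add_vecMulVec, Matrix.sub_mulVec] at h1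
    have h3 : vecMulVec b c *ᵥ x = q • b := by
      ext i
      simp [Matrix.vecMulVec_mulVec, hqx, mul_comm]
    rw [h3] at h1
    rw [add_smul, one_smul]
    exact eq_add_of_sub_eq h1
  have h3 : x = (1 + q) • ((pencil A)⁻¹ *ᵥ b) := by
    rw [← Matrix.mulVec_smul, ← h2, Matrix.mulVec_mulVec,
      Matrix.nonsing_inv_mul _ (isUnit_det_pencil _), Matrix.one_mulVec]
  have h4 : q = (1 + q) * transferFunction A B C := by
    conv_lhs => rw [hqx, h3, dotProduct_smul, smul_eq_mul]
    rfl
  linear_combination h4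

end Transfer

/-! ### Existence of minimal block-diagonal realizations -/

/-- Two roots of an irreducible real polynomial differ by an automorphism of `ℂ` over `ℝ`, which is
the identity or conjugation. Hence splitting roots by modulus can be done over `ℝ`. -/
lemma norm_eq_of_irreducible {p : ℝ[X]} (hp : Irreducible p) {z w : ℂ} (hz : aeval z p = 0)
    (hw : aeval w p = 0) : ‖z‖ = ‖w‖ := by
  have h : IsConjRoot ℝ z w :=
    (minpoly.eq_of_irreducible hp hz).symm.trans (minpoly.eq_of_irreducible hp hw)
  have : IsAlgClosure ℝ ℂ := ⟨inferInstance, inferInstance⟩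
  have : Normal ℝ ℂ := IsAlgClosure.normal ℝ ℂ
  obtain ⟨σ, rfl⟩ := isConjRoot_iff_exists_algEquiv.1 h
  rcases Complex.real_algHom_eq_id_or_conj (σ : ℂ →ₐ[ℝ] ℂ) with h | h
  · have := DFunLike.congr_fun h w
    simp at this
    rw [this]
  · have := DFunLike.congr_fun h w
    simp at this
    rw [this, Complex.norm_conj]

/-- A real polynomial splits into a factor with roots in the closed unit disc and a factor with
roots outside. -/
lemma exists_mul_eq_of_norm (E : ℝ[X]) (hE : E ≠ 0) :
    ∃ a b : ℝ[X], E = a * b ∧ (∀ z : ℂ, aeval z a = 0 → ‖z‖ ≤ 1) ∧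
      ∀ z : ℂ, aeval z b = 0 → 1 < ‖z‖ := by
  induction E using WfDvdMonoid.induction_on_irreducible with
  | zero => exact absurd rfl hE
  | unit u hu =>
    obtain ⟨c, hc, rfl⟩ := Polynomial.isUnit_iff.1 hu
    refine ⟨Polynomial.C c, 1, by simp, fun z hz => ?_, fun z hz => ?_⟩
    · simp [hc.ne_zero] at hz
    · simp at hz
  | mul q p hq hp ih =>
    obtain ⟨a, b, rfl, ha, hb⟩ := ih hq
    by_cases h : ∀ z : ℂ, aeval z p = 0 → ‖z‖ ≤ 1
    · refine ⟨p * a, b, by ring, fun z hz => ?_, hb⟩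
      rw [map_mul, mul_eq_zero] at hz
      exact hz.elim (h z) (ha z)
    · push Not at h
      -- One root of the irreducible factor outside the disc puts all of them outside.
      obtain ⟨w, hw, hw1⟩ := h
      refine ⟨a, p * b, by ring, ha, fun z hz => ?_⟩
      rw [map_mul, mul_eq_zero] at hz
      exact hz.elim (fun hz => by rwa [norm_eq_of_irreducible hp hz hw]) (hb z)

lemma exists_monic_mul_eq_of_norm {E : ℝ[X]} (hE : E.Monic) :
    ∃ a b : ℝ[X], a.Monic ∧ b.Monic ∧ E = a * b ∧ (∀ z : ℂ, aeval z a = 0 → ‖z‖ ≤ 1) ∧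
      ∀ z : ℂ, aeval z b = 0 → 1 < ‖z‖ := by
  obtain ⟨a, b, h, ha, hb⟩ := exists_mul_eq_of_norm E hE.ne_zero
  have h1 : a.leadingCoeff * b.leadingCoeff = 1 := by
    rw [← Polynomial.leadingCoeff_mul, ← h, hE.leadingCoeff]
  have ha0 : a.leadingCoeff ≠ 0 := left_ne_zero_of_mul_eq_one h1
  have hb0 : b.leadingCoeff ≠ 0 := right_ne_zero_of_mul_eq_one h1
  refine ⟨a * Polynomial.C a.leadingCoeff⁻¹, b * Polynomial.C b.leadingCoeff⁻¹,
    Polynomial.monic_mul_leadingCoeff_inv (by simpa using ha0),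
    Polynomial.monic_mul_leadingCoeff_inv (by simpa using hb0), ?_, fun z hz => ha z ?_,
    fun z hz => hb z ?_⟩
  · have : a * Polynomial.C a.leadingCoeff⁻¹ * (b * Polynomial.C b.leadingCoeff⁻¹) =
        a * b * Polynomial.C ((a.leadingCoeff * b.leadingCoeff)⁻¹) := by
      rw [mul_inv, Polynomial.C_mul]; ring
    rw [this, h1, h]; simp
  · simpa [ha0] using hz
  · simpa [hb0] using hz

/-- Every monic polynomial is the characteristic polynomial of a matrix with a cyclic vector. -/
lemma exists_cyclic_matrix {p : ℝ[X]} (hp : p.Monic) :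
    ∃ (A : Matrix (Fin p.natDegree) (Fin p.natDegree) ℝ) (B : Fin p.natDegree → ℝ),
      A.charpoly = p ∧ ∀ q : ℝ[X], aeval A q *ᵥ B = 0 → p ∣ q := by
  -- The matrix is multiplication by the root on `ℝ[X]/(p)` and the cyclic vector is the class of
  -- `1`, so `q(A) B` is the coordinate vector of the class of `q`.
  let h := AdjoinRoot.powerBasis' hp
  have hgen : h.gen = AdjoinRoot.root p := AdjoinRoot.powerBasis'_gen hp
  refine ⟨Algebra.leftMulMatrix h.basis h.gen, h.basis.repr 1, ?_, fun q hq => ?_⟩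
  · refine (charpoly_leftMulMatrix h).trans ?_
    rw [hgen]
    refine (minpoly.unique ℝ _ hp (by simp) fun q hq hq0 => ?_).symm
    rw [AdjoinRoot.aeval_eq, AdjoinRoot.mk_eq_zero] at hq0
    exact Polynomial.degree_le_of_dvd hq0 hq.ne_zero
  · have h1 := Algebra.leftMulMatrix_mulVec_repr h.basis (aeval h.gen q) 1
    rw [← Polynomial.aeval_algHom_apply] at h1
    have h2 := h1.symm.trans hq
    rw [mul_one] at h2
    have h3 : aeval h.gen q = 0 := by
      apply h.basis.repr.injective
      ext i
      exact (congrFun h2 i).trans (by rw [map_zero]; rfl)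
    rwa [hgen, AdjoinRoot.aeval_eq, AdjoinRoot.mk_eq_zero] at h3

lemma aeval_fromBlocks {s m : ℕ} (As : Matrix (Fin s) (Fin s) ℝ) (Au : Matrix (Fin m) (Fin m) ℝ)
    (q : ℝ[X]) : aeval (fromBlocks As 0 0 Au) q = fromBlocks (aeval As q) 0 0 (aeval Au q) := by
  induction q using Polynomial.induction_on' with
  | add a b ha hb => simp [ha, hb, fromBlocks_add]
  | monomial n a =>
    simp [aeval_monomial, Algebra.algebraMap_eq_smul_one, fromBlocks_diagonal_pow,
      Matrix.fromBlocks_smul]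

section Numerator

variable {ι : Type*} [Fintype ι] [DecidableEq ι]

/-- The numerators of the transfer functions of a controllable pair, for the possible output
vectors, are all polynomials of degree less than the dimension. -/
lemma IsControllable.exists_output {A : Matrix ι ι ℝ} {B : ι → ℝ} (h : IsControllable A B)
    {N : ℝ[X]} (hN : N.degree < Fintype.card ι) :
    ∃ C : ι → ℝ, algebraMap ℝ[X] (RatFunc ℝ) A.charpoly * transferFunction A B C =
      algebraMap ℝ[X] (RatFunc ℝ) N := by
  let T : (ι → ℝ) →ₗ[ℝ] RatFunc ℝ :=
    { toFun := fun C => algebraMap ℝ[X] (RatFunc ℝ) A.charpoly * transferFunction A B C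
      map_add' := fun C C' => by rw [transferFunction_add_right, mul_add]
      map_smul' := fun a C => by
        rw [transferFunction_smul_right, RingHom.id_apply, RatFunc.smul_eq_C_mul]; ring }
  let V : Submodule ℝ (RatFunc ℝ) :=
    (Polynomial.degreeLT ℝ (Fintype.card ι)).map
      (IsScalarTower.toAlgHom ℝ ℝ[X] (RatFunc ℝ)).toLinearMap
  have hle : LinearMap.range T ≤ V := by
    rintro _ ⟨C, rfl⟩
    obtain ⟨g, hg, hg'⟩ := exists_numerator A B C
    exact ⟨g, Polynomial.mem_degreeLT.2 hg, hg'.symm⟩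
  -- `T` takes values in a space of the same dimension, so injectivity suffices; an output vector in
  -- the kernel is an unobservable state of the transposed, observable system.
  have hinj : Function.Injective T := by
    rw [injective_iff_map_eq_zero]
    intro C hC
    have h0 : transferFunction A B C = 0 :=
      (mul_eq_zero.1 hC).resolve_left (algebraMap_charpoly_ne_zero A)
    rw [← transferFunction_transpose] at h0
    have h1 := dotProduct_pow_mulVec_eq_zero _ _ _ h0
    rw [← Matrix.transpose_transpose A] at h
    refine h.isObservable_transpose C fun k => h1 k
  have hV : Module.finrank ℝ V = Fintype.card ι := by
    have hi : Function.Injective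
        (IsScalarTower.toAlgHom ℝ ℝ[X] (RatFunc ℝ)).toLinearMap :=
      RatFunc.algebraMap_injective ℝ
    rw [← (Submodule.equivMapOfInjective _ hi _).finrank_eq,
      (Polynomial.degreeLTEquiv ℝ _).finrank_eq, Module.finrank_fin_fun]
  have heq : LinearMap.range T = V := by
    have : FiniteDimensional ℝ V := by
      have := (Polynomial.degreeLTEquiv ℝ (Fintype.card ι)).symm.finiteDimensional
      infer_instance
    refine Submodule.eq_of_le_of_finrank_eq hle ?_
    rw [hV, LinearMap.finrank_range_of_inj hinj, Module.finrank_fintype_fun_eq_card]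
  have hNV : algebraMap ℝ[X] (RatFunc ℝ) N ∈ V := ⟨N, Polynomial.mem_degreeLT.2 hN, rfl⟩
  rw [← heq] at hNV
  exact hNV

end Numerator

lemma denom_eq_of_isCoprime {K : RatFunc ℝ} {N E : ℝ[X]} (hE : E.Monic) (hcop : IsCoprime N E)
    (h : algebraMap ℝ[X] (RatFunc ℝ) E * K = algebraMap ℝ[X] (RatFunc ℝ) N) : K.denom = E := by
  have h1 : K.denom ∣ E := denom_dvd_of_mul_eq h
  have h2 : E ∣ K.denom := by
    have h3 : K.denom * N = K.num * E := by
      apply RatFunc.algebraMap_injective ℝ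
      rw [map_mul, map_mul, ← denom_mul_eq, ← h]
      ring
    exact hcop.symm.dvd_of_dvd_mul_right (h3 ▸ Dvd.intro_left _ rfl)
  exact Polynomial.eq_of_monic_of_associated (RatFunc.monic_denom K) hE
    (associated_of_dvd_dvd h1 h2)

lemma mem_eigenvalues_iff {ι : Type*} [Fintype ι] [DecidableEq ι] (A : Matrix ι ι ℝ) (z : ℂ) :
    z ∈ eigenvalues A ↔ aeval z A.charpoly = 0 := by
  rw [eigenvalues, Matrix.charpoly_map, Polynomial.mem_roots
    ((Polynomial.map_ne_zero A.charpoly_monic.ne_zero)), Polynomial.IsRoot, Polynomial.eval_map,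
    Polynomial.aeval_def]

/-- Every strictly proper transfer function has a minimal realization which separates the poles
outside the closed unit disc from the others. -/
theorem exists_realization (K : RatFunc ℝ) (hK : IsStrictlyCausal K) :
    ∃ s m : ℕ, Nonempty (Realization K s m) := by
  obtain ⟨a, b, ha, hb, hab, ha1, hb1⟩ := exists_monic_mul_eq_of_norm (RatFunc.monic_denom K)
  obtain ⟨As, Bs, hAs, hBs⟩ := exists_cyclic_matrix ha
  obtain ⟨Au, Bu, hAu, hBu⟩ := exists_cyclic_matrix hb
  have hcop : IsCoprime a b := by
    refine (Polynomial.isCoprime_iff_aeval_ne_zero_of_isAlgClosed ℝ ℂ a b).2 fun z => ?_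
    by_contra! h
    exact absurd (ha1 z h.1) (not_le.2 (hb1 z h.2))
  have hcard : Fintype.card (Fin a.natDegree ⊕ Fin b.natDegree) = K.denom.natDegree := by
    rw [hab, ha.natDegree_mul hb]; simp
  have hc : IsControllable (fromBlocks As 0 0 Au) (Sum.elim Bs Bu) := by
    -- An annihilator of the joint input vector annihilates both cyclic blocks, so it is divisible
    -- by `a` and `b`, and by coprimality by `a * b`.
    refine isControllable_of_forall_dvd (E := K.denom) (fun q hq => ?_) hcard.le
    rw [aeval_fromBlocks, Matrix.fromBlocks_mulVec] at hq
    rw [hab]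
    refine hcop.mul_dvd (hBs q ?_) (hBu q ?_)
    · ext i; simpa using congrFun hq (Sum.inl i)
    · ext i; simpa using congrFun hq (Sum.inr i)
  have hchar : (fromBlocks As 0 0 Au).charpoly = K.denom := by
    rw [Matrix.charpoly_fromBlocks_zero₁₂, hAs, hAu, hab]
  have hdeg : K.num.degree < Fintype.card (Fin a.natDegree ⊕ Fin b.natDegree) := by
    rw [hcard, ← Polynomial.degree_eq_natDegree K.denom_ne_zero]
    exact hK
  obtain ⟨C, hC⟩ := hc.exists_output hdeg
  have htf : transferFunction (fromBlocks As 0 0 Au) (Sum.elim Bs Bu) C = K := by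
    rw [hchar, ← denom_mul_eq] at hC
    exact mul_left_cancel₀ (by simpa using K.denom_ne_zero) hC
  have hCe : Sum.elim (C ∘ Sum.inl) (C ∘ Sum.inr) = C := Sum.elim_comp_inl_inr C
  refine ⟨_, _, ⟨⟨As, Au, Bs, Bu, C ∘ Sum.inl, C ∘ Sum.inr, ?_, ?_, hc, ?_, ?_⟩⟩⟩
  · intro z hz
    rw [mem_eigenvalues_iff, hAs] at hz
    exact ha1 z hz
  · intro z hz
    rw [mem_eigenvalues_iff, hAu] at hz
    exact hb1 z hz
  · rw [hCe]
    exact isObservable_of_card_le (B := Sum.elim Bs Bu) (by rw [htf, hcard])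
  · rw [hCe, htf]

/-! ### The open loop `Q (1 + Q)⁻¹` -/

section OpenLoop

variable {Q : RatFunc ℝ}

lemma monic_denom_add_num (hQc : IsStrictlyCausal Q) : (Q.denom + Q.num).Monic :=
  (RatFunc.monic_denom Q).add_of_left hQc

lemma degree_denom_add_num (hQc : IsStrictlyCausal Q) :
    (Q.denom + Q.num).degree = Q.denom.degree :=
  Polynomial.degree_add_eq_left_of_degree_lt hQc

lemma denom_mul_one_add (Q : RatFunc ℝ) : algebraMap ℝ[X] (RatFunc ℝ) Q.denom * (1 + Q) =
    algebraMap ℝ[X] (RatFunc ℝ) (Q.denom + Q.num) := by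
  rw [mul_add, denom_mul_eq, map_add, mul_one]

lemma one_add_ne_zero (hQc : IsStrictlyCausal Q) : 1 + Q ≠ 0 := by
  intro h
  have := denom_mul_one_add Q
  rw [h, mul_zero] at this
  exact (monic_denom_add_num hQc).ne_zero
    (RatFunc.algebraMap_injective ℝ (this.symm.trans (map_zero _).symm))

lemma mul_openLoop (hQc : IsStrictlyCausal Q) :
    algebraMap ℝ[X] (RatFunc ℝ) (Q.denom + Q.num) * (Q * (1 + Q)⁻¹) =
      algebraMap ℝ[X] (RatFunc ℝ) Q.num := by
  have h := one_add_ne_zero hQc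
  rw [← denom_mul_one_add, ← denom_mul_eq]
  field_simp

/-- `N` and `D + N` are coprime because `N` and `D` are: nothing cancels, and the poles of `K` are
exactly the zeros of `1 + Q`. -/
lemma denom_openLoop (hQc : IsStrictlyCausal Q) :
    (Q * (1 + Q)⁻¹).denom = Q.denom + Q.num := by
  refine denom_eq_of_isCoprime (monic_denom_add_num hQc) ?_ (mul_openLoop hQc)
  have := RatFunc.isCoprime_num_denom Q
  simpa using this.add_mul_left_right 1

lemma num_openLoop (hQc : IsStrictlyCausal Q) : (Q * (1 + Q)⁻¹).num = Q.num := by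
  apply RatFunc.algebraMap_injective ℝ
  rw [← denom_mul_eq, denom_openLoop hQc, mul_openLoop hQc]

lemma isStrictlyCausal_openLoop (hQc : IsStrictlyCausal Q) :
    IsStrictlyCausal (Q * (1 + Q)⁻¹) := by
  rw [IsStrictlyCausal, denom_openLoop hQc, num_openLoop hQc, degree_denom_add_num hQc]
  exact hQc

end OpenLoop

/-! ### Characteristic polynomials of the open and the closed loop -/

namespace Realization

variable {K : RatFunc ℝ} {s m : ℕ} (S : Realization K s m)

/-- The state matrix of the realization. -/
def A : Matrix (Fin s ⊕ Fin m) (Fin s ⊕ Fin m) ℝ := fromBlocks S.As 0 0 S.Au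

/-- The input vector of the realization. -/
def B : Fin s ⊕ Fin m → ℝ := Sum.elim S.Bs S.Bu

/-- The output vector of the realization. -/
def C : Fin s ⊕ Fin m → ℝ := Sum.elim S.Cs S.Cu

/-- The closed-loop state matrix `A + B C`. -/
def F : Matrix (Fin s ⊕ Fin m) (Fin s ⊕ Fin m) ℝ := S.A + vecMulVec S.B S.C

lemma charpoly_A : S.A.charpoly = K.denom := by
  have h := charpoly_eq_denom S.controllable S.observable
  rw [S.transfer] at h
  exact h

lemma charpoly_As_mul_charpoly_Au : S.As.charpoly * S.Au.charpoly = K.denom := by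
  rw [← S.charpoly_A, A, Matrix.charpoly_fromBlocks_zero₁₂]

end Realization

section ClosedLoop

variable {Q : RatFunc ℝ} {s m : ℕ} (S : Realization (Q * (1 + Q)⁻¹) s m)

lemma transferFunction_F (hQc : IsStrictlyCausal Q) : transferFunction S.F S.B S.C = Q := by
  have h : transferFunction S.F S.B S.C * (1 - transferFunction S.A S.B S.C) =
    transferFunction S.A S.B S.C := transferFunction_add_vecMulVec S.A S.B S.C
  have h1 : transferFunction S.A S.B S.C = Q * (1 + Q)⁻¹ := S.transfer
  have h2 := one_add_ne_zero hQc
  rw [h1] at h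
  field_simp at h
  linear_combination h

/-- `(D + N)(1 - K) = (D + N)/(1 + Q) = D`. Thus stability of the transfer function `Q` is stability
of the entire closed-loop state. -/
lemma charpoly_F (hQc : IsStrictlyCausal Q) : S.F.charpoly = Q.denom := by
  apply RatFunc.algebraMap_injective ℝ
  have h1 : transferFunction S.A S.B S.C = Q * (1 + Q)⁻¹ := S.transfer
  have h2 := one_add_ne_zero hQc
  rw [Realization.F, charpoly_add_vecMulVec, h1, S.charpoly_A, denom_openLoop hQc,
    ← denom_mul_one_add]
  field_simp
  ring

end ClosedLoop

/-! ### The rate -/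

lemma freq_eq (G : RatFunc ℝ) (θ : ℝ) :
    freq G θ = aeval (circleMap 0 1 θ) G.num / aeval (circleMap 0 1 θ) G.denom := by
  simp [freq, RatFunc.eval, circleMap, Polynomial.aeval_def]

lemma IsRHInf.aeval_denom_ne_zero {G : RatFunc ℝ} (hG : IsRHInf G) (θ : ℝ) :
    aeval (circleMap 0 1 θ) G.denom ≠ 0 := by
  intro h
  have := hG.2 _ h
  simp at this

lemma IsRHInf.continuous_freq {G : RatFunc ℝ} (hG : IsRHInf G) : Continuous (freq G) := by
  have h : ∀ p : ℝ[X], Continuous fun θ : ℝ => aeval (circleMap 0 1 θ) p := fun p =>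
    (Polynomial.continuous_aeval p).comp (continuous_circleMap 0 1)
  simp only [funext (freq_eq G)]
  exact (h _).div (h _) hG.aeval_denom_ne_zero

lemma IsRHInf.continuous_psd {G : RatFunc ℝ} (hG : IsRHInf G) : Continuous (psd G) :=
  hG.continuous_freq.norm.pow 2

lemma integral_neg_pi_pi_eq_circleAverage (f : ℂ → ℝ) :
    1 / (2 * Real.pi) * ∫ θ in (-Real.pi)..Real.pi, f (circleMap 0 1 θ) =
      Real.circleAverage f 0 1 := by
  have hp : Function.Periodic (fun θ => f (circleMap 0 1 θ)) (2 * Real.pi) := fun θ => by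
    simp only [periodic_circleMap 0 1 θ]
  have := hp.intervalIntegral_add_eq (-Real.pi) 0
  rw [Real.circleAverage_def, smul_eq_mul, one_div]
  congr 1
  rw [zero_add] at this
  rw [← this]
  congr 1
  ring

/-- The sum of the logarithms of the moduli of the roots outside the unit disc, for a monic
polynomial. -/
lemma logMahlerMeasure_map_of_monic {p : ℝ[X]} (hp : p.Monic) :
    (p.map (algebraMap ℝ ℂ)).logMahlerMeasure =
      ((p.map (algebraMap ℝ ℂ)).roots.map fun a => Real.posLog ‖a‖).sum := by
  rw [Polynomial.logMahlerMeasure_eq_log_leadingCoeff_add_sum_log_roots,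
    (hp.map (algebraMap ℝ ℂ)).leadingCoeff]
  simp

lemma sum_posLog_eq_zero {s : Multiset ℂ} (h : ∀ z ∈ s, ‖z‖ ≤ 1) :
    (s.map fun a => Real.posLog ‖a‖).sum = 0 := by
  refine Multiset.sum_eq_zero fun x hx => ?_
  obtain ⟨z, hz, rfl⟩ := Multiset.mem_map.1 hx
  exact Real.posLog_eq_zero_iff _ |>.2 (by simpa using h z hz)

lemma mem_roots_map_iff {p : ℝ[X]} (hp : p ≠ 0) (z : ℂ) :
    z ∈ (p.map (algebraMap ℝ ℂ)).roots ↔ aeval z p = 0 := by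
  rw [Polynomial.mem_roots (Polynomial.map_ne_zero hp), Polynomial.IsRoot, Polynomial.eval_map,
    Polynomial.aeval_def]

/-- On the circle `log |1 + Q|` is `log |D + N| - log |D|`, and the Mahler measure of the monic `D`
is trivial because its roots lie in the disc. -/
lemma rate_eq_logMahlerMeasure {Q : RatFunc ℝ} (hQ : IsRHInf Q) (hQc : IsStrictlyCausal Q) :
    rate Q = ((Q.denom + Q.num).map (algebraMap ℝ ℂ)).logMahlerMeasure / Real.log 2 := by
  set E := (Q.denom + Q.num).map (algebraMap ℝ ℂ) with hE
  set D := Q.denom.map (algebraMap ℝ ℂ) with hD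
  have hE0 : E ≠ 0 := Polynomial.map_ne_zero (monic_denom_add_num hQc).ne_zero
  have hDev : ∀ θ, D.eval (circleMap 0 1 θ) = aeval (circleMap 0 1 θ) Q.denom := fun θ => by
    rw [hD, Polynomial.eval_map, Polynomial.aeval_def]
  have hEev : ∀ θ, E.eval (circleMap 0 1 θ) =
      aeval (circleMap 0 1 θ) Q.denom + aeval (circleMap 0 1 θ) Q.num := fun θ => by
    rw [hE, Polynomial.eval_map, ← Polynomial.aeval_def, map_add]
  have hD0 : D.logMahlerMeasure = 0 := by
    rw [hD, logMahlerMeasure_map_of_monic (RatFunc.monic_denom Q)]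
    refine sum_posLog_eq_zero fun z hz => ?_
    rw [mem_roots_map_iff Q.denom_ne_zero] at hz
    exact (hQ.2 z hz).le
  have h1 : rate Q = Real.circleAverage
      (fun z => Real.logb 2 ‖1 + aeval z Q.num / aeval z Q.denom‖) 0 1 := by
    rw [← integral_neg_pi_pi_eq_circleAverage, rate]
    simp only [freq_eq]
  have h2 : Real.circleAverage
      (fun z => Real.logb 2 ‖1 + aeval z Q.num / aeval z Q.denom‖) 0 1 =
      (E.logMahlerMeasure - D.logMahlerMeasure) / Real.log 2 := by
    rw [Polynomial.logMahlerMeasure_def, Polynomial.logMahlerMeasure_def, Real.circleAverage_def,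
      Real.circleAverage_def, Real.circleAverage_def, ← smul_sub,
      ← intervalIntegral.integral_sub E.intervalIntegrable_mahlerMeasure
        D.intervalIntegrable_mahlerMeasure, smul_eq_mul, smul_eq_mul, mul_div_assoc,
      ← intervalIntegral.integral_div]
    congr 1
    -- Zeros of `1 + Q` on the circle are allowed. They are finitely many, and `circleMap` is
    -- injective on the half-open period, so the exceptional angles form a null set.
    apply intervalIntegral.integral_congr_ae
    rw [MeasureTheory.ae_iff]
    apply Set.Finite.measure_zero _ MeasureTheory.volume
    simp only [Classical.not_imp]
    apply Set.Finite.of_finite_image (f := circleMap 0 1) _ <|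
      (injOn_circleMap_of_abs_sub_le one_ne_zero
        (by simp [le_of_eq, Real.pi_nonneg])).mono (fun _ h ↦ h.1)
    apply E.roots.finite_toSet.subset
    rintro _ ⟨θ, ⟨_, h⟩, rfl⟩
    contrapose h
    have hEθ : E.eval (circleMap 0 1 θ) ≠ 0 := by
      simpa [Polynomial.mem_roots hE0] using h
    have hDθ := hQ.aeval_denom_ne_zero θ
    have h3 : 1 + aeval (circleMap 0 1 θ) Q.num / aeval (circleMap 0 1 θ) Q.denom =
        E.eval (circleMap 0 1 θ) / D.eval (circleMap 0 1 θ) := by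
      rw [hEev, hDev]; field_simp
    rw [h3, norm_div, Real.logb, Real.log_div (norm_ne_zero_iff.2 hEθ)
      (norm_ne_zero_iff.2 (by rwa [hDev]))]
  rw [h1, h2, hD0, sub_zero]

/-- The roots of `D + N` are the eigenvalues of both blocks; those of `As`, even on the circle, have
`posLog` zero. -/
theorem rate_eq_sum {Q : RatFunc ℝ} (hQ : IsRHInf Q) (hQc : IsStrictlyCausal Q) {s m : ℕ}
    (S : Realization (Q * (1 + Q)⁻¹) s m) :
    rate Q = ((eigenvalues S.Au).map fun z => Real.logb 2 ‖z‖).sum := by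
  rw [rate_eq_logMahlerMeasure hQ hQc, logMahlerMeasure_map_of_monic (monic_denom_add_num hQc),
    ← denom_openLoop hQc, ← S.charpoly_As_mul_charpoly_Au, Polynomial.map_mul,
    Polynomial.roots_mul (mul_ne_zero (Polynomial.map_ne_zero S.As.charpoly_monic.ne_zero)
      (Polynomial.map_ne_zero S.Au.charpoly_monic.ne_zero)), Multiset.map_add, Multiset.sum_add,
    ← Matrix.charpoly_map, ← Matrix.charpoly_map]
  change ((Multiset.map _ (eigenvalues S.As)).sum + (Multiset.map _ (eigenvalues S.Au)).sum) / _ = _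
  rw [sum_posLog_eq_zero S.eig_s, zero_add, div_eq_mul_inv, ← Multiset.sum_map_mul_right]
  congr 1
  refine Multiset.map_congr rfl fun z hz => ?_
  rw [Real.posLog_eq_log (by simpa using (S.eig_u z hz).le), Real.logb, div_eq_mul_inv]

lemma det_eq_prod_eigenvalues {ι : Type*} [Fintype ι] [DecidableEq ι] (A : Matrix ι ι ℝ) :
    ((A.det : ℝ) : ℂ) = (eigenvalues A).prod := by
  rw [eigenvalues, ← Matrix.det_eq_prod_roots_charpoly]
  exact RingHom.map_det (algebraMap ℝ ℂ) A

/-- The rate determines the factor by which the encoder expands volumes. -/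
lemma abs_det_Au {Q : RatFunc ℝ} (hQ : IsRHInf Q) (hQc : IsStrictlyCausal Q) {s m : ℕ}
    (S : Realization (Q * (1 + Q)⁻¹) s m) : |S.Au.det| = 2 ^ rate Q := by
  have h2 : |S.Au.det| = ((eigenvalues S.Au).map fun z => ‖z‖).prod := by
    rw [← Real.norm_eq_abs, ← Complex.norm_real, det_eq_prod_eigenvalues]
    exact map_multiset_prod (normHom : ℂ →*₀ ℝ) _
  have h3 : ∀ t : Multiset ℂ, (∀ z ∈ t, 1 < ‖z‖) →
      (t.map fun z => ‖z‖).prod = (2 : ℝ) ^ (t.map fun z => Real.logb 2 ‖z‖).sum := by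
    intro t
    induction t using Multiset.induction_on with
    | empty => simp
    | cons a t ih =>
      intro h
      have ha := h a (Multiset.mem_cons_self a t)
      rw [Multiset.map_cons, Multiset.prod_cons, Multiset.map_cons, Multiset.sum_cons,
        Real.rpow_add two_pos, Real.rpow_logb two_pos (by norm_num) (by linarith),
        ih fun z hz => h z (Multiset.mem_cons_of_mem hz)]
  rw [h2, h3 _ S.eig_u, rate_eq_sum hQ hQc S]

/-! ### Powers of stable matrices -/

section Stable

variable {ι : Type*} [Fintype ι] [DecidableEq ι]

attribute [local instance] Matrix.linftyOpNormedRing Matrix.linftyOpNormedAlgebra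

/-- Gelfand's formula, with `ρ` strictly between the spectral radius and `1`. -/
lemma exists_norm_pow_le {M : Matrix ι ι ℂ} (h : ∀ z ∈ M.charpoly.roots, ‖z‖ < 1) :
    ∃ c > 0, ∃ ρ, 0 < ρ ∧ ρ < 1 ∧ ∀ n, ‖M ^ n‖ ≤ c * ρ ^ n := by
  -- The spectral radius bound below needs a nonempty spectrum.
  cases isEmpty_or_nonempty ι
  · refine ⟨1, one_pos, 1 / 2, by norm_num, by norm_num, fun n => ?_⟩
    rw [Subsingleton.elim (M ^ n) 0, norm_zero]
    positivity
  have hsp : spectralRadius ℂ M < 1 := by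
    have h1 := spectrum.spectralRadius_lt_of_forall_lt_of_nonempty (𝕜 := ℂ) (spectrum.nonempty M)
      (r := 1) fun k hk => by
        rw [Matrix.mem_spectrum_iff_isRoot_charpoly] at hk
        exact h k ((Polynomial.mem_roots M.charpoly_monic.ne_zero).2 hk)
    exact_mod_cast h1
  obtain ⟨r, hr1, hr2⟩ := ENNReal.lt_iff_exists_nnreal_btwn.1 hsp
  have hr2 : r < 1 := by exact_mod_cast hr2
  have hev :=
    (spectrum.pow_nnnorm_pow_one_div_tendsto_nhds_spectralRadius M).eventually_lt_const hr1
  have hr0 : 0 < r := by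
    have : (0 : ENNReal) < r := bot_le.trans_lt hr1
    exact_mod_cast this
  have hO : (fun n : ℕ => M ^ n) =O[atTop] fun n : ℕ => (r : ℝ) ^ n := by
    refine Asymptotics.IsBigO.of_bound 1 ?_
    filter_upwards [hev, eventually_gt_atTop 0] with n hn hn0
    have h2 : (‖M ^ n‖₊ : ENNReal) < (r : ENNReal) ^ (n : ℝ) := by
      have := ENNReal.rpow_lt_rpow hn (by exact_mod_cast hn0 : (0 : ℝ) < n)
      rwa [← ENNReal.rpow_mul, one_div, inv_mul_cancel₀ (by exact_mod_cast hn0.ne'),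
        ENNReal.rpow_one] at this
    rw [ENNReal.rpow_natCast] at h2
    have h3 : ‖M ^ n‖₊ < r ^ n := by exact_mod_cast h2
    have h4 : ‖M ^ n‖ < (r : ℝ) ^ n := by exact_mod_cast h3
    rw [one_mul, Real.norm_of_nonneg (by positivity)]
    exact h4.le
  obtain ⟨c, hc, hb⟩ := Asymptotics.bound_of_isBigO_nat_atTop hO
  refine ⟨c, hc, r, by exact_mod_cast hr0, by exact_mod_cast hr2, fun n => ?_⟩
  have := hb (x := n) (pow_ne_zero _ (by exact_mod_cast hr0.ne'))
  rwa [Real.norm_of_nonneg (by positivity)] at this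

lemma exists_abs_pow_apply_le {A : Matrix ι ι ℝ} (h : ∀ z ∈ eigenvalues A, ‖z‖ < 1) :
    ∃ c > 0, ∃ ρ, 0 < ρ ∧ ρ < 1 ∧ ∀ n i j, |(A ^ n) i j| ≤ c * ρ ^ n := by
  obtain ⟨c, hc, ρ, h0, h1, hb⟩ := exists_norm_pow_le (M := A.map (algebraMap ℝ ℂ)) h
  refine ⟨c, hc, ρ, h0, h1, fun n i j => le_trans ?_ (hb n)⟩
  have h2 : (A.map (algebraMap ℝ ℂ)) ^ n = (A ^ n).map (algebraMap ℝ ℂ) :=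
    (map_pow (algebraMap ℝ ℂ).mapMatrix A n).symm
  rw [h2, Matrix.linfty_opNorm_def]
  have h3 : |(A ^ n) i j| = ‖((A ^ n).map (algebraMap ℝ ℂ)) i j‖₊ := by simp
  rw [h3, NNReal.coe_le_coe]
  refine le_trans ?_ (Finset.le_sup (Finset.mem_univ i))
  exact Finset.single_le_sum (f := fun j => ‖((A ^ n).map (algebraMap ℝ ℂ)) i j‖₊)
    (fun _ _ => zero_le) (Finset.mem_univ j)

end Stable

lemma abs_dotProduct_mulVec_le {ι : Type*} [Fintype ι] (M : Matrix ι ι ℝ) {t : ℝ}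
    (h : ∀ i j, |M i j| ≤ t) (c v : ι → ℝ) :
    |c ⬝ᵥ (M *ᵥ v)| ≤ t * ((∑ i, |c i|) * ∑ j, |v j|) := by
  rw [Finset.sum_mul_sum, Finset.mul_sum]
  simp only [dotProduct, Matrix.mulVec, Finset.mul_sum]
  refine (Finset.abs_sum_le_sum_abs _ _).trans (Finset.sum_le_sum fun i _ => ?_)
  refine (Finset.abs_sum_le_sum_abs _ _).trans (Finset.sum_le_sum fun j _ => ?_)
  rw [abs_mul, abs_mul]
  have := mul_le_mul_of_nonneg_right (h i j) (mul_nonneg (abs_nonneg (c i)) (abs_nonneg (v j)))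
  linarith

/-! ### The state of the closed loop -/

namespace Realization

variable {K : RatFunc ℝ} {s m : ℕ} (S : Realization K s m)

/-- The state `(X_s, X̂_u + X̃_u)`, which obeys the closed-loop dynamics driven by the noise. -/
def state (x₀ : Fin m → ℝ) (w : ℕ → ℝ) (k : ℕ) : Fin s ⊕ Fin m → ℝ :=
  Sum.elim (S.loop x₀ w k).xs ((S.loop x₀ w k).xhat + (S.loop x₀ w k).xtil)

lemma channelInput_eq (x₀ : Fin m → ℝ) (w : ℕ → ℝ) (k : ℕ) :
    S.channelInput x₀ w k = S.C ⬝ᵥ S.state x₀ w k := by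
  simp only [channelInput, input, feedback, C, state, dotProduct, Fintype.sum_sum_type,
    Sum.elim_inl, Sum.elim_inr, Pi.add_apply, mul_add, Finset.sum_add_distrib]
  ring

/-- Both unstable states evolve by `A_u`, so their sum does too, driven by `Y = C x + W`; the term
`B C x` is absorbed into `F`. -/
lemma state_succ (x₀ : Fin m → ℝ) (w : ℕ → ℝ) (k : ℕ) :
    S.state x₀ w (k + 1) = S.F *ᵥ S.state x₀ w k + w k • S.B := by
  have h := S.channelInput_eq x₀ w k
  rw [channelInput] at h
  have hF : S.F *ᵥ S.state x₀ w k =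
      S.A *ᵥ S.state x₀ w k + (S.C ⬝ᵥ S.state x₀ w k) • S.B := by
    rw [F, Matrix.add_mulVec, Matrix.vecMulVec_mulVec]
    ext i
    simp [mul_comm]
  rw [hF, ← h, add_assoc, ← add_smul]
  ext (i | i)
  · simp [state, loop, step, A, B, Matrix.fromBlocks_mulVec]
  · simp [state, loop, step, A, B, Matrix.fromBlocks_mulVec, Matrix.mulVec_add]
    ring

lemma state_eq (x₀ : Fin m → ℝ) (w : ℕ → ℝ) (n : ℕ) :
    S.state x₀ w n = S.F ^ n *ᵥ Sum.elim 0 x₀ +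
      ∑ i ∈ Finset.range n, w i • (S.F ^ (n - 1 - i) *ᵥ S.B) := by
  induction n with
  | zero => simp [state, loop]
  | succ n ih =>
    rw [state_succ, ih, Matrix.mulVec_add, Matrix.mulVec_mulVec, ← pow_succ',
      Finset.sum_range_succ, Matrix.mulVec_sum, add_assoc]
    congr 2
    · refine Finset.sum_congr rfl fun i hi => ?_
      have : n + 1 - 1 - i = n - 1 - i + 1 := by have := Finset.mem_range.1 hi; omega
      rw [Matrix.mulVec_smul, Matrix.mulVec_mulVec, this, pow_succ']
    · simp

/-- Splits every coordinate into a deterministic part carrying the message and a noise functional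
independent of it. -/
lemma dotProduct_state (c : Fin s ⊕ Fin m → ℝ) (x₀ : Fin m → ℝ) (w : ℕ → ℝ) (n : ℕ) :
    c ⬝ᵥ S.state x₀ w n = c ⬝ᵥ (S.F ^ n *ᵥ Sum.elim 0 x₀) +
      ∑ i ∈ Finset.range n, c ⬝ᵥ (S.F ^ (n - 1 - i) *ᵥ S.B) * w i := by
  rw [state_eq, dotProduct_add, dotProduct_sum]
  simp only [dotProduct_smul, smul_eq_mul, mul_comm]

lemma loop_xtil (x₀ : Fin m → ℝ) (w : ℕ → ℝ) (n : ℕ) :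
    (S.loop x₀ w n).xtil = S.Au ^ n *ᵥ x₀ := by
  induction n with
  | zero => simp [loop]
  | succ n ih => rw [pow_succ', ← Matrix.mulVec_mulVec, ← ih]; rfl

lemma isUnit_det_Au : IsUnit S.Au.det := by
  rw [isUnit_iff_ne_zero]
  intro h
  have h0 : (0 : ℂ) ∈ eigenvalues S.Au := by
    rw [← Multiset.prod_eq_zero_iff, ← det_eq_prod_eigenvalues, h, Complex.ofReal_zero]
  have := S.eig_u 0 h0
  rw [norm_zero] at this
  linarith

/-- The error of the estimate, expanded by the encoder, is the unstable part of the state. -/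
lemma pow_mulVec_estimate_sub (x₀ : Fin m → ℝ) (w : ℕ → ℝ) (n : ℕ) :
    S.Au ^ n *ᵥ (S.estimate x₀ w n - x₀) = -fun i => S.state x₀ w n (Sum.inr i) := by
  have h : S.Au ^ n * S.Au⁻¹ ^ n = 1 := by
    rw [Matrix.inv_pow', Matrix.mul_nonsing_inv]
    rw [Matrix.det_pow]
    exact S.isUnit_det_Au.pow n
  rw [estimate, Matrix.mulVec_sub, Matrix.mulVec_neg, Matrix.mulVec_mulVec, h, Matrix.one_mulVec,
    ← S.loop_xtil x₀ w n]
  ext i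
  simp [state]
  ring

end Realization

/-- The closed loop is stable. -/
lemma exists_abs_dotProduct_pow_F_le {Q : RatFunc ℝ} (hQ : IsRHInf Q) (hQc : IsStrictlyCausal Q)
    {s m : ℕ} (S : Realization (Q * (1 + Q)⁻¹) s m) :
    ∃ t > 0, ∃ ρ, 0 < ρ ∧ ρ < 1 ∧ ∀ (n : ℕ) (c v : Fin s ⊕ Fin m → ℝ),
      |c ⬝ᵥ (S.F ^ n *ᵥ v)| ≤ t * ρ ^ n * ((∑ i, |c i|) * ∑ j, |v j|) := by
  obtain ⟨t, ht, ρ, h0, h1, hb⟩ := exists_abs_pow_apply_le (A := S.F) fun z hz => by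
    rw [mem_eigenvalues_iff, charpoly_F S hQc] at hz
    exact hQ.2 z hz
  exact ⟨t, ht, ρ, h0, h1, fun n c v => abs_dotProduct_mulVec_le _ (hb n) c v⟩

/-! ### Linear functionals of the noise -/

/-- The double cosine sum has the shape of the autocovariances, which turns variances into integrals
against the spectrum. -/
lemma norm_sq_sum_circleMap (a : ℕ → ℝ) (n : ℕ) (θ : ℝ) :
    ‖∑ i ∈ Finset.range n, (a i : ℂ) * circleMap 0 1 θ ^ i‖ ^ 2 =
      ∑ i ∈ Finset.range n, ∑ j ∈ Finset.range n,
        a i * a j * Real.cos (((i : ℝ) - (j : ℝ)) * θ) := by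
  have hz : ∀ i : ℕ, circleMap 0 1 θ ^ i = Complex.exp (((i * θ : ℝ) : ℂ) * Complex.I) := by
    intro i
    rw [circleMap, zero_add, Complex.ofReal_one, one_mul, ← Complex.exp_nat_mul]
    congr 1
    push_cast
    ring
  have hre : ∀ i : ℕ, ((a i : ℂ) * circleMap 0 1 θ ^ i).re = a i * Real.cos (i * θ) := fun i => by
    rw [hz, Complex.re_ofReal_mul, Complex.exp_ofReal_mul_I_re]
  have him : ∀ i : ℕ, ((a i : ℂ) * circleMap 0 1 θ ^ i).im = a i * Real.sin (i * θ) := fun i => by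
    rw [hz, Complex.im_ofReal_mul, Complex.exp_ofReal_mul_I_im]
  rw [Complex.sq_norm, Complex.normSq_apply, Complex.re_sum, Complex.im_sum,
    Finset.sum_mul_sum, Finset.sum_mul_sum, ← Finset.sum_add_distrib]
  refine Finset.sum_congr rfl fun i _ => ?_
  rw [← Finset.sum_add_distrib]
  refine Finset.sum_congr rfl fun j _ => ?_
  rw [hre, hre, him, him, sub_mul, Real.cos_sub]
  ring

lemma psd_nonneg (H : RatFunc ℝ) (θ : ℝ) : 0 ≤ psd H θ := sq_nonneg _

section Noise

variable {Ω : Type*} [MeasurableSpace Ω] {P : Measure Ω} {H : RatFunc ℝ} {W : ℕ → Ω → ℝ}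

lemma IsChannelNoise.hasGaussianLaw_sum (hW : IsChannelNoise H W P) (a : ℕ → ℝ) (n : ℕ) :
    HasGaussianLaw (fun ω => ∑ i ∈ Finset.range n, a i * W i ω) P :=
  (hW.gaussian.smul a).hasGaussianLaw_fun_sum

lemma IsChannelNoise.integral_sum (hW : IsChannelNoise H W P) (a : ℕ → ℝ) (n : ℕ) :
    ∫ ω, ∑ i ∈ Finset.range n, a i * W i ω ∂P = 0 := by
  rw [integral_finsetSum]
  · simp [integral_const_mul, hW.mean_zero]
  · exact fun i _ => (hW.gaussian.hasGaussianLaw_eval i).integrable.const_mul _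

variable [IsProbabilityMeasure P]

/-- The variance of a linear functional of the noise, in the frequency domain. -/
lemma IsChannelNoise.variance_sum (hW : IsChannelNoise H W P) (hH : IsRHInf H) (a : ℕ → ℝ)
    (n : ℕ) : Var[fun ω => ∑ i ∈ Finset.range n, a i * W i ω; P] =
      1 / (2 * Real.pi) * ∫ θ in (-Real.pi)..Real.pi,
        ‖∑ i ∈ Finset.range n, (a i : ℂ) * circleMap 0 1 θ ^ i‖ ^ 2 * psd H θ := by
  have hm : ∀ i ∈ Finset.range n, MemLp (fun ω => a i * W i ω) 2 P := fun i _ =>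
    (hW.gaussian.hasGaussianLaw_eval i).memLp_two.const_mul _
  have hcont : ∀ i j : ℕ, Continuous fun θ : ℝ =>
      a i * a j * (psd H θ * Real.cos (((i : ℝ) - (j : ℝ)) * θ)) := fun i j => by
    have := hH.continuous_psd
    fun_prop
  rw [← covariance_self (hW.hasGaussianLaw_sum a n).aemeasurable,
    covariance_fun_sum_fun_sum' hm hm]
  simp only [covariance_const_mul_left, covariance_const_mul_right, hW.autocov,
    norm_sq_sum_circleMap, Finset.sum_mul]
  rw [intervalIntegral.integral_finsetSum, Finset.mul_sum]
  · refine Finset.sum_congr rfl fun i _ => ?_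
    rw [intervalIntegral.integral_finsetSum, Finset.mul_sum]
    · refine Finset.sum_congr rfl fun j _ => ?_
      have : ∀ θ, a i * a j * Real.cos (((i : ℝ) - (j : ℝ)) * θ) * psd H θ =
          a i * a j * (psd H θ * Real.cos (((i : ℝ) - (j : ℝ)) * θ)) := fun θ => by ring
      simp only [this]
      rw [intervalIntegral.integral_const_mul]
      ring
    · intro j _
      refine Continuous.intervalIntegrable ?_ _ _
      have := hcont i j
      convert this using 2
      ring
  · intro i _
    refine Continuous.intervalIntegrable ?_ _ _
    refine continuous_finsetSum _ fun j _ => ?_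
    have := hcont i j
    convert this using 2
    ring

lemma IsChannelNoise.integral_const_add_sum_sq (hW : IsChannelNoise H W P) (hH : IsRHInf H)
    (a : ℕ → ℝ) (n : ℕ) (μ : ℝ) :
    ∫ ω, (μ + ∑ i ∈ Finset.range n, a i * W i ω) ^ 2 ∂P =
      μ ^ 2 + 1 / (2 * Real.pi) * ∫ θ in (-Real.pi)..Real.pi,
        ‖∑ i ∈ Finset.range n, (a i : ℂ) * circleMap 0 1 θ ^ i‖ ^ 2 * psd H θ := by
  have hG := hW.hasGaussianLaw_sum a n
  have h0 := hW.integral_sum a n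
  rw [← hW.variance_sum hH, variance_of_integral_eq_zero hG.aemeasurable h0]
  have h1 : ∀ ω, (μ + ∑ i ∈ Finset.range n, a i * W i ω) ^ 2 =
      μ ^ 2 + 2 * μ * (∑ i ∈ Finset.range n, a i * W i ω) +
        (∑ i ∈ Finset.range n, a i * W i ω) ^ 2 := fun ω => by ring
  simp only [h1]
  rw [integral_add, integral_add, integral_const_mul, h0]
  · simp
  · exact integrable_const _
  · exact hG.integrable.const_mul _
  · exact (integrable_const _).add (hG.integrable.const_mul _)
  · exact hG.memLp_two.integrable_sq

lemma norm_sum_circleMap_le (a : ℕ → ℝ) (n : ℕ) (θ : ℝ) :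
    ‖∑ i ∈ Finset.range n, (a i : ℂ) * circleMap 0 1 θ ^ i‖ ≤ ∑ i ∈ Finset.range n, |a i| := by
  refine (norm_sum_le _ _).trans (Finset.sum_le_sum fun i _ => ?_)
  simp

lemma continuous_sum_circleMap (a : ℕ → ℝ) (n : ℕ) :
    Continuous fun θ : ℝ => ∑ i ∈ Finset.range n, (a i : ℂ) * circleMap 0 1 θ ^ i := by
  have := continuous_circleMap (0 : ℂ) 1
  fun_prop

/-- On the unit circle a polynomial is bounded by the sum of the moduli of its coefficients. -/
lemma IsChannelNoise.variance_sum_le (hW : IsChannelNoise H W P) (hH : IsRHInf H) (a : ℕ → ℝ)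
    (n : ℕ) : Var[fun ω => ∑ i ∈ Finset.range n, a i * W i ω; P] ≤
      (∑ i ∈ Finset.range n, |a i|) ^ 2 *
        (1 / (2 * Real.pi) * ∫ θ in (-Real.pi)..Real.pi, psd H θ) := by
  rw [hW.variance_sum hH, mul_left_comm]
  have hc := hH.continuous_psd
  refine mul_le_mul_of_nonneg_left ?_ (by positivity)
  rw [← intervalIntegral.integral_const_mul]
  refine intervalIntegral.integral_mono_on (by linarith [Real.pi_pos]) ?_ ?_ fun θ _ => ?_
  · exact (((continuous_sum_circleMap a n).norm.pow 2).mul hc).intervalIntegrable _ _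
  · exact (hc.const_mul _).intervalIntegrable _ _
  · refine mul_le_mul_of_nonneg_right ?_ (psd_nonneg H θ)
    exact pow_le_pow_left₀ (norm_nonneg _) (norm_sum_circleMap_le a n θ) 2

end Noise

/-! ### The input power -/

section Power

variable {Q : RatFunc ℝ} {s m : ℕ} (S : Realization (Q * (1 + Q)⁻¹) s m)

lemma sum_abs_impulse_le {t ρ : ℝ} (ht : 0 < t) (h0 : 0 < ρ) (h1 : ρ < 1)
    (hb : ∀ (n : ℕ) (c v : Fin s ⊕ Fin m → ℝ),
      |c ⬝ᵥ (S.F ^ n *ᵥ v)| ≤ t * ρ ^ n * ((∑ i, |c i|) * ∑ j, |v j|))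
    (c : Fin s ⊕ Fin m → ℝ) (n : ℕ) :
    ∑ i ∈ Finset.range n, |c ⬝ᵥ (S.F ^ (n - 1 - i) *ᵥ S.B)| ≤
      t * ((∑ i, |c i|) * ∑ j, |S.B j|) * (1 - ρ)⁻¹ := by
  rw [Finset.sum_range_reflect (fun i => |c ⬝ᵥ (S.F ^ i *ᵥ S.B)|)]
  calc ∑ i ∈ Finset.range n, |c ⬝ᵥ (S.F ^ i *ᵥ S.B)|
      ≤ ∑ i ∈ Finset.range n, t * ((∑ i, |c i|) * ∑ j, |S.B j|) * ρ ^ i :=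
        Finset.sum_le_sum fun i _ => (hb i c S.B).trans_eq (by ring)
    _ ≤ _ := by
        rw [← Finset.mul_sum]
        refine mul_le_mul_of_nonneg_left ?_ (by positivity)
        rw [← tsum_geometric_of_lt_one h0.le h1]
        exact (summable_geometric_of_lt_one h0.le h1).sum_le_tsum _ fun i _ => by positivity

/-- The truncated impulse responses of the closed loop converge to `Q` on the unit circle. -/
lemma tendsto_norm_sum_impulse (hQ : IsRHInf Q) (hQc : IsStrictlyCausal Q) (θ : ℝ) :
    Tendsto (fun n => ‖∑ i ∈ Finset.range n,
      ((S.C ⬝ᵥ (S.F ^ (n - 1 - i) *ᵥ S.B) : ℝ) : ℂ) * circleMap 0 1 θ ^ i‖) atTop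
      (𝓝 ‖freq Q θ‖) := by
  obtain ⟨t, ht, ρ, h0, h1, hb⟩ := exists_abs_dotProduct_pow_F_le hQ hQc S
  set z := circleMap 0 1 θ with hz
  have hz1 : ‖z‖ = 1 := by simp [hz]
  have hD : aeval z Q.denom ≠ 0 := hQ.aeval_denom_ne_zero θ
  -- Numerators for the unit input vectors, fixed once: the remainder will depend on `n` only
  -- through the coordinates of `F ^ n B`.
  choose p hp using fun j => exists_numerator S.F (Pi.single j 1) S.C
  have hnum : ∀ v, algebraMap ℝ[X] (RatFunc ℝ) Q.denom * transferFunction S.F v S.C =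
      algebraMap ℝ[X] (RatFunc ℝ) (∑ j, Polynomial.C (v j) * p j) := by
    intro v
    have hT : transferFunction S.F v S.C =
        ∑ j, RatFunc.C (v j) * transferFunction S.F (Pi.single j 1) S.C := by
      let T : (Fin s ⊕ Fin m → ℝ) →ₗ[ℝ] RatFunc ℝ :=
        { toFun := fun v => transferFunction S.F v S.C
          map_add' := fun v w => transferFunction_add_left _ _ _ _
          map_smul' := fun a v => by
            rw [transferFunction_smul_left, RingHom.id_apply, RatFunc.smul_eq_C_mul] }
      have := LinearMap.pi_apply_eq_sum_univ T v
      simp only [RatFunc.smul_eq_C_mul] at this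
      refine this.trans (Finset.sum_congr rfl fun j _ => ?_)
      have hs : (fun i => if j = i then (1 : ℝ) else 0) = Pi.single j 1 := by
        ext i
        simp [Pi.single_apply, eq_comm]
      rw [hs]
      rfl
    rw [hT, Finset.mul_sum, map_sum]
    refine Finset.sum_congr rfl fun j _ => ?_
    rw [map_mul, ← (hp j).2, charpoly_F S hQc, RatFunc.algebraMap_C]
    ring
  -- The iterated resolvent identity divided by `D` and evaluated at `z`. The truncated response is
  -- reversed in time, so it approximates `z ^ n Q(z)`, whose modulus is that of `Q(z)`.
  have key : ∀ n, z ^ n * freq Q θ - ∑ i ∈ Finset.range n,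
      ((S.C ⬝ᵥ (S.F ^ (n - 1 - i) *ᵥ S.B) : ℝ) : ℂ) * z ^ i =
      ∑ j, (((S.F ^ n *ᵥ S.B) j : ℝ) : ℂ) * (aeval z (p j) / aeval z Q.denom) := by
    intro n
    have h2 := X_pow_mul_transferFunction S.F S.B S.C n
    rw [transferFunction_F S hQc] at h2
    have h3 : (X : ℝ[X]) ^ n * Q.num = Q.denom * (∑ j ∈ Finset.range n,
        Polynomial.C (S.C ⬝ᵥ (S.F ^ j *ᵥ S.B)) * Polynomial.X ^ (n - 1 - j)) +
        ∑ j, Polynomial.C ((S.F ^ n *ᵥ S.B) j) * p j := by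
      apply RatFunc.algebraMap_injective ℝ
      rw [map_add, map_mul, map_mul, map_pow, ← hnum, RatFunc.algebraMap_X, ← denom_mul_eq,
        ← mul_add, ← h2]
      ring
    have h4 := congrArg (aeval z) h3
    simp only [map_add, map_mul, map_sum, map_pow, aeval_X, aeval_C] at h4
    rw [← Finset.sum_range_reflect] at h4
    have h5 : ∀ i ∈ Finset.range n, n - 1 - (n - 1 - i) = i := fun i hi => by
      have := Finset.mem_range.1 hi; omega
    rw [Finset.sum_congr rfl fun i hi => by rw [h5 i hi]] at h4
    rw [freq_eq, ← hz]
    simp only [mul_div_assoc']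
    rw [← Finset.sum_div, eq_div_iff hD, sub_mul, div_mul_cancel₀ _ hD, h4]
    simp only [Complex.coe_algebraMap]
    ring
  have hlim : Tendsto (fun n => z ^ n * freq Q θ - ∑ i ∈ Finset.range n,
      ((S.C ⬝ᵥ (S.F ^ (n - 1 - i) *ᵥ S.B) : ℝ) : ℂ) * z ^ i) atTop (𝓝 0) := by
    simp only [key]
    rw [← Finset.sum_const_zero (s := (Finset.univ : Finset (Fin s ⊕ Fin m)))]
    refine tendsto_finsetSum _ fun j _ => ?_
    have h2 : Tendsto (fun n => (S.F ^ n *ᵥ S.B) j) atTop (𝓝 0) := by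
      have h3 := fun n => hb n (Pi.single j 1) S.B
      simp only [single_one_dotProduct] at h3
      refine squeeze_zero_norm h3 ?_
      have := ((tendsto_pow_atTop_nhds_zero_of_lt_one h0.le h1).const_mul t).mul_const
        ((∑ i, |(Pi.single j 1 : Fin s ⊕ Fin m → ℝ) i|) * ∑ j, |S.B j|)
      simpa using this
    have h4 := ((Complex.continuous_ofReal.tendsto 0).comp h2).mul_const
      (aeval z (p j) / aeval z Q.denom)
    simpa using h4
  rw [tendsto_iff_norm_sub_tendsto_zero]
  refine squeeze_zero (fun n => norm_nonneg _) (fun n => ?_)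
    (tendsto_zero_iff_norm_tendsto_zero.1 hlim)
  have h6 : ‖freq Q θ‖ = ‖z ^ n * freq Q θ‖ := by rw [norm_mul, norm_pow, hz1, one_pow, one_mul]
  rw [h6, Real.norm_eq_abs, abs_sub_comm]
  exact abs_norm_sub_norm_le _ _

/-- The variance of the channel input. -/
def inputVariance (H : RatFunc ℝ) (n : ℕ) : ℝ :=
  1 / (2 * Real.pi) * ∫ θ in (-Real.pi)..Real.pi,
    ‖∑ i ∈ Finset.range n,
      ((S.C ⬝ᵥ (S.F ^ (n - 1 - i) *ᵥ S.B) : ℝ) : ℂ) * circleMap 0 1 θ ^ i‖ ^ 2 * psd H θ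

/-- Dominated convergence: the truncated responses are bounded on the circle by a geometric series,
uniformly in `n`. -/
lemma tendsto_inputVariance {H : RatFunc ℝ} (hH : IsRHInf H) (hQ : IsRHInf Q)
    (hQc : IsStrictlyCausal Q) : Tendsto (inputVariance S H) atTop (𝓝 (power Q H)) := by
  obtain ⟨t, ht, ρ, h0, h1, hb⟩ := exists_abs_dotProduct_pow_F_le hQ hQc S
  have hc := hH.continuous_psd
  refine Tendsto.const_mul _ ?_
  refine intervalIntegral.tendsto_integral_filter_of_dominated_convergence
    (fun θ => (t * ((∑ i, |S.C i|) * ∑ j, |S.B j|) * (1 - ρ)⁻¹) ^ 2 * psd H θ) ?_ ?_ ?_ ?_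
  · refine Eventually.of_forall fun n => Continuous.aestronglyMeasurable ?_
    exact ((continuous_sum_circleMap (fun i => S.C ⬝ᵥ (S.F ^ (n - 1 - i) *ᵥ S.B)) n).norm.pow
      2).mul hc
  · refine Eventually.of_forall fun n => Eventually.of_forall fun θ _ => ?_
    rw [Real.norm_of_nonneg (mul_nonneg (sq_nonneg _) (psd_nonneg H θ))]
    refine mul_le_mul_of_nonneg_right ?_ (psd_nonneg H θ)
    refine pow_le_pow_left₀ (norm_nonneg _) ?_ 2
    exact (norm_sum_circleMap_le (fun i => S.C ⬝ᵥ (S.F ^ (n - 1 - i) *ᵥ S.B)) n θ).trans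
      (sum_abs_impulse_le S ht h0 h1 hb S.C n)
  · exact (hc.const_mul _).intervalIntegrable _ _
  · refine Eventually.of_forall fun θ _ => ?_
    exact ((tendsto_norm_sum_impulse S hQ hQc θ).pow 2).mul_const _

lemma sum_abs_le_of_mem_messageCube {x₀ : Fin m → ℝ} (hx : x₀ ∈ messageCube m) :
    ∑ j, |(Sum.elim 0 x₀ : Fin s ⊕ Fin m → ℝ) j| ≤ m := by
  rw [Fintype.sum_sum_type]
  simp only [Sum.elim_inl, Sum.elim_inr, Pi.zero_apply, abs_zero, Finset.sum_const_zero, zero_add]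
  calc ∑ j, |x₀ j| ≤ ∑ _j : Fin m, (1 : ℝ) :=
        Finset.sum_le_sum fun j _ => (hx j).trans (by norm_num)
    _ = m := by simp

/-- `E[U(k)²]` is squared mean plus variance. The variance does not involve `x₀`, and the squared
mean is at most `e k → 0` on the whole cube. -/
theorem tendstoUniformlyOn_avgPower {Ω : Type*} [MeasurableSpace Ω] {P : Measure Ω}
    [IsProbabilityMeasure P] {H : RatFunc ℝ} {W : ℕ → Ω → ℝ} (hW : IsChannelNoise H W P)
    (hH : IsRHInf H) (hQ : IsRHInf Q) (hQc : IsStrictlyCausal Q) :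
    TendstoUniformlyOn (S.avgPower P W) (fun _ => power Q H) atTop (messageCube m) := by
  obtain ⟨t, ht, ρ, h0, h1, hb⟩ := exists_abs_dotProduct_pow_F_le hQ hQc S
  set e : ℕ → ℝ := fun k => (t * ρ ^ k * ((∑ i, |S.C i|) * m)) ^ 2 with he
  have hetend : Tendsto e atTop (𝓝 0) := by
    have := (((tendsto_pow_atTop_nhds_zero_of_lt_one h0.le h1).const_mul t).mul_const
      ((∑ i, |S.C i|) * m)).pow 2
    rwa [mul_zero, zero_mul, zero_pow two_ne_zero] at this
  have hsq : ∀ k x₀, ∫ ω, S.channelInput x₀ (fun i => W i ω) k ^ 2 ∂P =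
      (S.C ⬝ᵥ (S.F ^ k *ᵥ Sum.elim 0 x₀)) ^ 2 + inputVariance S H k := by
    intro k x₀
    simp only [S.channelInput_eq, S.dotProduct_state]
    exact hW.integral_const_add_sum_sq hH (fun i => S.C ⬝ᵥ (S.F ^ (k - 1 - i) *ᵥ S.B)) k _
  have hmean : ∀ k, ∀ x₀ ∈ messageCube m, (S.C ⬝ᵥ (S.F ^ k *ᵥ Sum.elim 0 x₀)) ^ 2 ≤ e k := by
    intro k x₀ hx
    rw [← sq_abs]
    refine pow_le_pow_left₀ (abs_nonneg _) ((hb k S.C _).trans ?_) 2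
    gcongr
    exact sum_abs_le_of_mem_messageCube hx
  have hv := (tendsto_inputVariance S hH hQ hQc).cesaro
  have hE := hetend.cesaro
  have hsum : Tendsto (fun n : ℕ => |(n : ℝ)⁻¹ * ∑ k ∈ Finset.range n, inputVariance S H k -
      power Q H| + (n : ℝ)⁻¹ * ∑ k ∈ Finset.range n, e k) atTop (𝓝 0) := by
    have := (hv.sub_const (power Q H)).abs.add hE
    simpa using this
  rw [Metric.tendstoUniformlyOn_iff]
  intro ε hε
  filter_upwards [hsum.eventually_lt_const hε] with n hn x₀ hx
  refine lt_of_le_of_lt ?_ hn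
  rw [dist_comm, Real.dist_eq, Realization.avgPower]
  simp only [hsq, Finset.sum_add_distrib, one_div, mul_add]
  have h2 : 0 ≤ (n : ℝ)⁻¹ * ∑ k ∈ Finset.range n, (S.C ⬝ᵥ (S.F ^ k *ᵥ Sum.elim 0 x₀)) ^ 2 := by
    positivity
  have h3 : (n : ℝ)⁻¹ * ∑ k ∈ Finset.range n, (S.C ⬝ᵥ (S.F ^ k *ᵥ Sum.elim 0 x₀)) ^ 2 ≤
      (n : ℝ)⁻¹ * ∑ k ∈ Finset.range n, e k :=
    mul_le_mul_of_nonneg_left (Finset.sum_le_sum fun k _ => hmean k x₀ hx) (by positivity)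
  rw [add_sub_assoc, add_comm]
  refine (abs_add_le _ _).trans (add_le_add le_rfl ?_)
  rwa [abs_of_nonneg h2]

end Power

/-! ### Packing message points into the cube -/

section Packing

variable {m : ℕ}

lemma volume_messageCube (m : ℕ) : volume (messageCube m) = 1 := by
  have h : messageCube m = Set.Icc (fun _ => -(1 / 2)) fun _ => 1 / 2 := by
    ext x
    simp only [messageCube, Set.mem_ofPred_eq, Set.mem_Icc, Pi.le_def, abs_le, forall_and]
  rw [h, Real.volume_Icc_pi]
  norm_num

lemma volume_setOf_norm_mulVec_sub_le {A : Matrix (Fin m) (Fin m) ℝ} (hA : A.det ≠ 0)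
    (x : Fin m → ℝ) {r : ℝ} (hr : 0 ≤ r) :
    volume {y | ‖A *ᵥ (y - x)‖ ≤ r} = ENNReal.ofReal ((2 * r) ^ m / |A.det|) := by
  have h : {y | ‖A *ᵥ (y - x)‖ ≤ r} =
      Matrix.toLin' A ⁻¹' Metric.closedBall (A *ᵥ x) r := by
    ext y
    simp [Matrix.mulVec_sub, dist_eq_norm]
  rw [h, Measure.addHaar_preimage_linearMap _ (by rwa [LinearMap.det_toLin']),
    Real.volume_pi_closedBall _ hr, LinearMap.det_toLin', ← ENNReal.ofReal_mul (abs_nonneg _),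
    Fintype.card_fin, abs_inv]
  congr 1
  ring

/-- As long as the sets excluded by the points chosen so far do not fill the cube, there is room for
another point. -/
lemma exists_separated_points {A : Matrix (Fin m) (Fin m) ℝ} (hA : A.det ≠ 0) {r : ℝ}
    (hr : 0 ≤ r) (M : ℕ) (hM : ∀ k : ℕ, k < M → k * (2 * r) ^ m < |A.det|) :
    ∃ p : Fin M → Fin m → ℝ, (∀ j, p j ∈ messageCube m) ∧
      ∀ i j, i ≠ j → r < ‖A *ᵥ (p i - p j)‖ := by
  induction M with
  | zero => exact ⟨fun _ => 0, fun j => j.elim0, fun i => i.elim0⟩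
  | succ M ih =>
    obtain ⟨p, hp, hsep⟩ := ih fun k hk => hM k (by omega)
    have hdet : 0 < |A.det| := abs_pos.2 hA
    have hvol : volume (⋃ j, {y | ‖A *ᵥ (y - p j)‖ ≤ r}) < volume (messageCube m) := by
      refine (measure_iUnion_fintype_le _ _).trans_lt ?_
      simp only [volume_setOf_norm_mulVec_sub_le hA _ hr, volume_messageCube, Finset.sum_const,
        Finset.card_univ, Fintype.card_fin, nsmul_eq_mul]
      rw [← ENNReal.ofReal_natCast, ← ENNReal.ofReal_mul (by positivity), ← ENNReal.ofReal_one,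
        ENNReal.ofReal_lt_ofReal_iff one_pos, ← mul_div_assoc, div_lt_one hdet]
      exact hM M (by omega)
    obtain ⟨x, hx, hx'⟩ : ∃ x ∈ messageCube m, x ∉ ⋃ j, {y | ‖A *ᵥ (y - p j)‖ ≤ r} := by
      by_contra! h
      exact absurd (measure_mono h) (not_le.2 hvol)
    simp only [Set.mem_iUnion, Set.mem_ofPred_eq, not_exists, not_le] at hx'
    refine ⟨Fin.snoc p x, fun j => ?_, fun i j hij => ?_⟩
    · induction j using Fin.lastCases with
      | last => simpa using hx
      | cast j => simpa using hp j
    · induction i using Fin.lastCases with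
      | last =>
        induction j using Fin.lastCases with
        | last => exact absurd rfl hij
        | cast j => simpa using hx' j
      | cast i =>
        induction j using Fin.lastCases with
        | last =>
          have := hx' i
          rw [← neg_sub, Matrix.mulVec_neg, norm_neg] at this
          simpa using this
        | cast j => simpa using hsep i j fun h => hij (by rw [h])

/-- A signalling whose detection rule is correct as long as the error of the estimate, expanded by
`A`, is at most `r`. -/
lemma exists_signalling {A : Matrix (Fin m) (Fin m) ℝ} (hA : A.det ≠ 0) {r : ℝ} (hr : 0 ≤ r)
    {M : ℕ} (hM0 : 0 < M) (hM : ∀ k : ℕ, k < M → k * (4 * r) ^ m < |A.det|) :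
    ∃ c : Signalling m M, ∀ j z, ‖A *ᵥ (z - c.point j)‖ ≤ r → c.detect z = j := by
  classical
  -- Separation `2 * r` makes the decoding regions of radius `r` disjoint; the excluded balls then
  -- have side `4 * r`.
  obtain ⟨p, hp, hsep⟩ := exists_separated_points hA (r := 2 * r) (by positivity) M
    (by simpa only [← mul_assoc, show (2 : ℝ) * 2 = 4 by norm_num] using hM)
  -- Estimates outside all regions are decoded as message `0`, an arbitrary default.
  let D : (Fin m → ℝ) → Fin M := fun z =>
    if h : ∃ j, ‖A *ᵥ (z - p j)‖ ≤ r then h.choose else ⟨0, hM0⟩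
  have hD : ∀ j z, ‖A *ᵥ (z - p j)‖ ≤ r → D z = j := by
    intro j z hz
    have hex : ∃ j, ‖A *ᵥ (z - p j)‖ ≤ r := ⟨j, hz⟩
    have h1 : D z = hex.choose := dif_pos hex
    by_contra hne
    rw [h1] at hne
    have h2 := hsep _ _ hne
    have h3 : A *ᵥ (p hex.choose - p j) = A *ᵥ (z - p j) - A *ᵥ (z - p hex.choose) := by
      rw [← Matrix.mulVec_sub]; congr 1; abel
    rw [h3] at h2
    linarith [norm_sub_le (A *ᵥ (z - p j)) (A *ᵥ (z - p hex.choose)), hex.choose_spec]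
  have hmeas : ∀ j, MeasurableSet {z | ‖A *ᵥ (z - p j)‖ ≤ r} := fun j => by
    refine (isClosed_le ?_ continuous_const).measurableSet
    fun_prop
  have hpre : ∀ j, D ⁻¹' {j} = {z | ‖A *ᵥ (z - p j)‖ ≤ r} ∪
      if j = ⟨0, hM0⟩ then (⋃ i, {z | ‖A *ᵥ (z - p i)‖ ≤ r})ᶜ else ∅ := by
    intro j
    ext z
    simp only [Set.mem_preimage, Set.mem_singleton_iff, Set.mem_union, Set.mem_ofPred_eq]
    by_cases hex : ∃ i, ‖A *ᵥ (z - p i)‖ ≤ r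
    · obtain ⟨i, hi⟩ := hex
      have hzi := hD i z hi
      constructor
      · intro h
        left
        rwa [← h, hzi]
      · rintro (h | h)
        · exact hD j z h
        · split_ifs at h with h0
          · exact absurd (Set.mem_iUnion.2 ⟨i, hi⟩) h
          · exact h.elim
    · have h1 : D z = ⟨0, hM0⟩ := dif_neg hex
      rw [h1]
      constructor
      · rintro rfl
        right
        simpa using hex
      · rintro (h | h)
        · exact absurd ⟨j, h⟩ hex
        · split_ifs at h with h0
          · exact h0.symm
          · exact h.elim
  refine ⟨⟨p, hp, D, measurable_to_countable' fun j => ?_⟩, hD⟩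
  rw [hpre]
  refine (hmeas j).union ?_
  split_ifs
  · exact (MeasurableSet.iUnion hmeas).compl
  · exact MeasurableSet.empty

/-- Fills in the small block lengths for which the packing inequality may fail. -/
lemma Signalling.nonempty {M : ℕ} (hM : 0 < M) : Nonempty (Signalling m M) :=
  ⟨⟨fun _ => 0, fun _ i => by simp, fun _ => ⟨0, hM⟩, measurable_const⟩⟩

end Packing

/-! ### The error probability -/

section Tail

variable {Ω : Type*} [MeasurableSpace Ω] {P : Measure Ω}

/-- The Gaussian tail bound. -/
lemma measureReal_abs_ge_le {G : Ω → ℝ} (hG : HasGaussianLaw G P) (h0 : ∫ ω, G ω ∂P = 0) {V : ℝ}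
    (hV : 0 < V) (hvar : Var[G; P] ≤ V) {r : ℝ} (hr : 0 ≤ r) :
    P.real {ω | r ≤ |G ω|} ≤ 2 * Real.exp (-r ^ 2 / (2 * V)) := by
  have hmap := hG.map_eq_gaussianReal
  -- Passing to the sub-Gaussian parameter `V` also covers a degenerate law of variance zero.
  have hsub : HasSubgaussianMGF G V.toNNReal P := by
    constructor
    · intro t
      have h1 : Integrable (fun x => Real.exp (t * x)) (P.map G) := by
        rw [hmap]; exact integrable_exp_mul_gaussianReal t
      exact h1.comp_aemeasurable hG.aemeasurable
    · intro t
      rw [mgf_gaussianReal hmap, h0, Real.exp_le_exp, zero_mul, zero_add,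
        Real.coe_toNNReal _ (variance_nonneg _ _), Real.coe_toNNReal _ hV.le]
      gcongr
  have h1 := hsub.measure_ge_le hr
  have h2 := hsub.neg.measure_ge_le hr
  rw [Real.coe_toNNReal _ hV.le] at h1 h2
  have hset : {ω | r ≤ |G ω|} = {ω | r ≤ G ω} ∪ {ω | r ≤ (-G) ω} := by
    ext ω; simp [le_abs]
  rw [hset, two_mul]
  exact (measureReal_union_le _ _).trans (add_le_add h1 h2)

variable {H : RatFunc ℝ} {W : ℕ → Ω → ℝ} {Q : RatFunc ℝ} {s m : ℕ}

lemma errorProb_nonneg {K : RatFunc ℝ} (S : Realization K s m) (n : ℕ) {M : ℕ}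
    (c : Signalling m M) : 0 ≤ errorProb P W S n c :=
  mul_nonneg (by positivity) (Finset.sum_nonneg fun _ _ => measureReal_nonneg)

variable [IsProbabilityMeasure P]

/-- The state of the stable closed loop has Gaussian tails, uniformly in time and in the message
point. -/
lemma exists_measureReal_state_le (S : Realization (Q * (1 + Q)⁻¹) s m)
    (hW : IsChannelNoise H W P) (hH : IsRHInf H) (hQ : IsRHInf Q) (hQc : IsStrictlyCausal Q) :
    ∃ b V : ℝ, 0 ≤ b ∧ 0 < V ∧ ∀ x₀ ∈ messageCube m, ∀ (n : ℕ) (r : ℝ), b ≤ r →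
      P.real {ω | r < ‖fun i => S.state x₀ (fun k => W k ω) n (Sum.inr i)‖} ≤
        m * (2 * Real.exp (-(r - b) ^ 2 / (2 * V))) := by
  obtain ⟨t, ht, ρ, h0, h1, hb⟩ := exists_abs_dotProduct_pow_F_le hQ hQc S
  set v := (t * (1 * ∑ j, |S.B j|) * (1 - ρ)⁻¹) ^ 2 *
    (1 / (2 * Real.pi) * ∫ θ in (-Real.pi)..Real.pi, psd H θ) with hv
  have hpsd : 0 ≤ ∫ θ in (-Real.pi)..Real.pi, psd H θ :=
    intervalIntegral.integral_nonneg (by linarith [Real.pi_pos]) fun θ _ => psd_nonneg H θ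
  have hv0 : 0 ≤ v := by positivity
  -- `t * m` bounds the mean of each coordinate over the cube; the `+ 1` keeps the variance bound
  -- positive.
  refine ⟨t * m, v + 1, by positivity, by positivity, fun x₀ hx n r hr => ?_⟩
  set a : Fin m → ℕ → ℝ := fun i k =>
    (Pi.single (Sum.inr i) 1 : Fin s ⊕ Fin m → ℝ) ⬝ᵥ (S.F ^ (n - 1 - k) *ᵥ S.B) with ha
  set μ : Fin m → ℝ := fun i =>
    (Pi.single (Sum.inr i) 1 : Fin s ⊕ Fin m → ℝ) ⬝ᵥ (S.F ^ n *ᵥ Sum.elim 0 x₀) with hμ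
  have hone : ∀ i : Fin m, ∑ k, |(Pi.single (Sum.inr i) 1 : Fin s ⊕ Fin m → ℝ) k| = 1 := by
    intro i
    rw [Finset.sum_eq_single (Sum.inr i)]
    · simp
    · intro k _ hk; simp [hk]
    · simp
  have hstate : ∀ w i, S.state x₀ w n (Sum.inr i) =
      μ i + ∑ k ∈ Finset.range n, a i k * w k := by
    intro w i
    rw [← S.dotProduct_state, single_one_dotProduct]
  have hμb : ∀ i, |μ i| ≤ t * m := by
    intro i
    refine (hb n _ _).trans ?_
    rw [hone, one_mul]
    have hρ : ρ ^ n ≤ 1 := pow_le_one₀ h0.le h1.le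
    calc _ ≤ t * 1 * (m : ℝ) := by
          gcongr
          exact sum_abs_le_of_mem_messageCube hx
      _ = _ := by ring
  have hvar : ∀ i, Var[fun ω => ∑ k ∈ Finset.range n, a i k * W k ω; P] ≤ v + 1 := by
    intro i
    refine (hW.variance_sum_le hH (a i) n).trans (le_trans ?_ (le_add_of_nonneg_right zero_le_one))
    have h2 := sum_abs_impulse_le S ht h0 h1 hb (Pi.single (Sum.inr i) 1) n
    rw [hone] at h2
    rw [hv]
    gcongr
  have hsub : {ω | r < ‖fun i => S.state x₀ (fun k => W k ω) n (Sum.inr i)‖} ⊆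
      ⋃ i, {ω | r - t * m ≤ |∑ k ∈ Finset.range n, a i k * W k ω|} := by
    intro ω hω
    by_contra hcon
    simp only [Set.mem_iUnion, Set.mem_ofPred_eq, not_exists, not_le] at hcon hω
    have hr0 : 0 ≤ r := le_trans (by positivity) hr
    refine absurd hω (not_lt.2 ((pi_norm_le_iff_of_nonneg hr0).2 fun i => ?_))
    rw [hstate, Real.norm_eq_abs]
    refine (abs_add_le _ _).trans ?_
    linarith [hcon i, hμb i]
  calc _ ≤ P.real (⋃ i, {ω | r - t * m ≤ |∑ k ∈ Finset.range n, a i k * W k ω|}) :=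
        measureReal_mono hsub
    _ ≤ ∑ i, P.real {ω | r - t * m ≤ |∑ k ∈ Finset.range n, a i k * W k ω|} :=
        measureReal_iUnion_fintype_le _
    _ ≤ ∑ _i : Fin m, 2 * Real.exp (-(r - t * m) ^ 2 / (2 * (v + 1))) :=
        Finset.sum_le_sum fun i _ => measureReal_abs_ge_le (hW.hasGaussianLaw_sum (a i) n)
          (hW.integral_sum (a i) n) (by positivity) (hvar i) (by linarith)
    _ = _ := by simp

/-- The error probability of a signalling matched to the expansion of the encoder is at most the
probability that the unstable part of the state is large. -/
lemma errorProb_le {K : RatFunc ℝ} (S : Realization K s m) (n : ℕ) {M : ℕ} (hM : 0 < M)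
    (c : Signalling m M) {r ε : ℝ}
    (hc : ∀ j z, ‖S.Au ^ n *ᵥ (z - c.point j)‖ ≤ r → c.detect z = j)
    (hε : ∀ x₀ ∈ messageCube m,
      P.real {ω | r < ‖fun i => S.state x₀ (fun k => W k ω) n (Sum.inr i)‖} ≤ ε) :
    errorProb P W S n c ≤ ε := by
  have hM' : (0 : ℝ) < M := by exact_mod_cast hM
  rw [errorProb, one_div, inv_mul_le_iff₀ hM']
  calc _ ≤ ∑ _j : Fin M, ε := Finset.sum_le_sum fun j _ => ?_
    _ = M * ε := by simp
  refine le_trans (measureReal_mono fun ω hω => ?_) (hε _ (c.point_mem j))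
  by_contra h
  simp only [Set.mem_ofPred_eq, not_lt] at h hω
  refine hω (hc j _ ?_)
  rwa [S.pow_mulVec_estimate_sub, norm_neg]

end Tail

/-! ### Achievability -/

/-- For `y - b ≥ 4V` the quadratic exponent exceeds `2(y - b)`, or equals it, and `2(y - b) ≥ y +
2m`. The surplus `2m` absorbs the prefactor through `2m ≤ exp (2m)`. -/
lemma gaussian_tail_le_exp_neg {m : ℕ} {b V y : ℝ} (hV : 0 < V)
    (hy1 : b + 4 * V ≤ y) (hy2 : 2 * b + 2 * m ≤ y) :
    m * (2 * Real.exp (-(y - b) ^ 2 / (2 * V))) ≤ Real.exp (-y) := by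
  have hu : 4 * V ≤ y - b := by linarith
  have h1 : 2 * (y - b) ≤ (y - b) ^ 2 / (2 * V) := by
    rw [le_div_iff₀ (by positivity)]
    nlinarith
  have h2 : -(y - b) ^ 2 / (2 * V) ≤ -y - 2 * m := by
    rw [neg_div]
    linarith
  have h3 : (2 * m : ℝ) ≤ Real.exp (2 * m) := by linarith [Real.add_one_le_exp (2 * m : ℝ)]
  calc m * (2 * Real.exp (-(y - b) ^ 2 / (2 * V)))
      = (2 * m) * Real.exp (-(y - b) ^ 2 / (2 * V)) := by ring
    _ ≤ Real.exp (2 * m) * Real.exp (-y - 2 * m) := by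
        gcongr
    _ = Real.exp (-y) := by rw [← Real.exp_add]; ring_nf

/-- After taking logarithms, a linear function of `n` with positive slope has to exceed the constant
`m * log 4`. -/
lemma eventually_packing {R C α : ℝ} (m : ℕ) (h : α * m + R * Real.log 2 < C * Real.log 2) :
    ∀ᶠ n : ℕ in atTop,
      (2 : ℝ) ^ ((n : ℝ) * R) * (4 * Real.exp (α * n)) ^ m ≤ ((2 : ℝ) ^ C) ^ n := by
  have hd : 0 < C * Real.log 2 - (α * m + R * Real.log 2) := by linarith
  have ht := (tendsto_natCast_atTop_atTop (R := ℝ)).const_mul_atTop hd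
  filter_upwards [ht.eventually_ge_atTop (m * Real.log 4)] with n hn
  have h4 : (4 : ℝ) ^ m = Real.exp (m * Real.log 4) := by
    rw [mul_comm, ← Real.rpow_def_of_pos (by norm_num), Real.rpow_natCast]
  rw [Real.rpow_def_of_pos two_pos, Real.rpow_def_of_pos two_pos, mul_pow, h4, ← Real.exp_nat_mul,
    ← Real.exp_nat_mul, ← Real.exp_add, ← Real.exp_add, Real.exp_le_exp]
  linarith

theorem achievesRate {Ω : Type*} [MeasurableSpace Ω] {P : Measure Ω}
    [IsProbabilityMeasure P] {H : RatFunc ℝ} {W : ℕ → Ω → ℝ} (hW : IsChannelNoise H W P)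
    (hH : IsRHInf H) {Q : RatFunc ℝ} (hQ : IsRHInf Q) (hQc : IsStrictlyCausal Q) {s m : ℕ}
    (S : Realization (Q * (1 + Q)⁻¹) s m) : AchievesRate P W S (rate Q) := by
  intro R hR
  obtain ⟨b, V, hb, hV, htail⟩ := exists_measureReal_state_le S hW hH hQ hQc
  have hl : 0 < Real.log 2 := Real.log_pos one_lt_two
  -- Dividing by `m + 1` rather than `m` keeps the packing inequality strict and allows `m = 0`.
  set α := (rate Q - R) * Real.log 2 / (m + 1) with hα
  have hα0 : 0 < α := div_pos (mul_pos (by linarith) hl) (by positivity)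
  have hαm : α * m + R * Real.log 2 < rate Q * Real.log 2 := by
    have : α * (m + 1) = (rate Q - R) * Real.log 2 := div_mul_cancel₀ _ (by positivity)
    linarith
  have hM0 : ∀ n : ℕ, 0 < ⌈(2 : ℝ) ^ ((n : ℝ) * R)⌉₊ := fun n => Nat.ceil_pos.2 (by positivity)
  have hdet : ∀ n, (S.Au ^ n).det ≠ 0 := fun n => by
    rw [Matrix.det_pow]; exact pow_ne_zero _ S.isUnit_det_Au.ne_zero
  -- The packing inequality is a premise inside the existential, so that one code can be chosen for
  -- every `n`.
  have hex : ∀ n : ℕ, ∃ c : Signalling m ⌈(2 : ℝ) ^ ((n : ℝ) * R)⌉₊,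
      (2 : ℝ) ^ ((n : ℝ) * R) * (4 * Real.exp (α * n)) ^ m ≤ ((2 : ℝ) ^ rate Q) ^ n →
      ∀ j z, ‖S.Au ^ n *ᵥ (z - c.point j)‖ ≤ Real.exp (α * n) → c.detect z = j := by
    intro n
    by_cases h : (2 : ℝ) ^ ((n : ℝ) * R) * (4 * Real.exp (α * n)) ^ m ≤ ((2 : ℝ) ^ rate Q) ^ n
    · obtain ⟨c, hc⟩ := exists_signalling (hdet n) (Real.exp_pos (α * n)).le (hM0 n)
        fun k hk => by
          rw [Matrix.det_pow, abs_pow, abs_det_Au hQ hQc S]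
          refine lt_of_lt_of_le ?_ h
          gcongr
          exact Nat.lt_ceil.1 hk
      exact ⟨c, fun _ => hc⟩
    · exact ⟨(Signalling.nonempty (hM0 n)).some, fun h' => absurd h' h⟩
  choose c hc using hex
  have hy : Tendsto (fun n : ℕ => Real.exp (α * n)) atTop atTop :=
    Real.tendsto_exp_atTop.comp ((tendsto_natCast_atTop_atTop (R := ℝ)).const_mul_atTop hα0)
  have hbound : ∀ᶠ n : ℕ in atTop, errorProb P W S n (c n) ≤ Real.exp (-(Real.exp (α * n))) := by
    filter_upwards [eventually_packing m hαm, hy.eventually_ge_atTop (b + 4 * V),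
      hy.eventually_ge_atTop (2 * b + 2 * m)] with n hn h1 h2
    refine (errorProb_le S n (hM0 n) (c n) (hc n hn) fun x₀ hx => htail x₀ hx n _ ?_).trans
      (gaussian_tail_le_exp_neg hV h1 h2)
    linarith
  refine ⟨c, ?_, 1, one_pos, α, hα0, by simpa only [one_mul] using hbound⟩
  refine squeeze_zero' (Eventually.of_forall fun n => errorProb_nonneg S n (c n)) hbound ?_
  exact Real.tendsto_exp_neg_atTop_nhds_zero.comp hy

end FeedbackCode

end

theorem mainTheorem3 {Ω : Type*} [MeasurableSpace Ω] (P : Measure Ω) [IsProbabilityMeasure P]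
    (H : RatFunc ℝ) (hH : FeedbackCode.IsRHInf H) (hcol : FeedbackCode.IsColored H)
    (W : ℕ → Ω → ℝ) (hW : FeedbackCode.IsChannelNoise H W P)
    (Q : RatFunc ℝ) (hQ : FeedbackCode.IsRHInf Q) (hQc : FeedbackCode.IsStrictlyCausal Q) :
    (∃ s m : ℕ, Nonempty (FeedbackCode.Realization (Q * (1 + Q)⁻¹) s m)) ∧
    ∀ (s m : ℕ) (S : FeedbackCode.Realization (Q * (1 + Q)⁻¹) s m),
      FeedbackCode.rate Q =
        ((FeedbackCode.eigenvalues S.Au).map fun z => Real.logb 2 ‖z‖).sum ∧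
      FeedbackCode.AchievesRate P W S (FeedbackCode.rate Q) ∧
      TendstoUniformlyOn (S.avgPower P W) (fun _ => FeedbackCode.power Q H) atTop
        (FeedbackCode.messageCube m) := by
  exact ⟨FeedbackCode.exists_realization _ (FeedbackCode.isStrictlyCausal_openLoop hQc),
    fun s m S => ⟨FeedbackCode.rate_eq_sum hQ hQc S, FeedbackCode.achievesRate hW hH hQ hQc S,
      FeedbackCode.tendstoUniformlyOn_avgPower S hW hH hQ hQc⟩⟩
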